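/- Let $T=pD^2+qD+r$ be a second-order differential operator, $D=d/dz$, with rational coefficients $p,q,r\in\mathbb{C}(z)$, $p\neq 0$. Suppose that $T$ is exceptional: there is a finite (possibly empty) set $K\subset\mathbb{N}$ such that, for $k\in\mathbb{N}$, $T$ has a polynomial eigenfunction of degree exactly $k$ if and only if $k\notin K$. Let $\mathcal U\subset\mathbb{C}[z]$ be the largest polynomial subspace with $T[\mathcal U]\subset\mathcal U$. For $\zeta\in\mathbb{C}$ let $I_\zeta=\{\operatorname{ord}_\zeta y: 0\ne y\in\mathcal U\}$ and let $\nu_\zeta$ be the number of elements of $\mathbb{N}\setminus I_\zeta$. A pole of $T$ is a pole of at least one of $p,q,r$. Let $\zeta_1,\dots,\zeta_N$ be the poles of $T$ and put $$\eta_T(z)=\prod_{i=1}^N (z-\zeta_i)^{\nu_{\zeta_i}} .$$ Then: 1. $p$ is a polynomial of degree at most $2$, and all sets $\mathbb{N}\setminus I_\zeta$ are finite. 2. There is a polynomial $s$ of degree at most $1$ such that $$q=\frac{p'}{2}+s-\frac{2p\,\eta_T'}{\eta_T},$$ and, with the same $s$, the following holds. 3. Up to an additive constant, $T$ is gauge-equivalent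 to a natural operator. Precisely: there are a constant $c\in\mathbb{C}$ and a nonzero rational function $\sigma$ such that $\hat T=\sigma T\sigma^{-1}$ is again an exceptional operator and, with $\eta=\eta_{\hat T}$ the polynomial built from the poles and gap cardinalities of $\hat T$, the equation $\hat T[y]=cy$ multiplied by $\eta$ is the bilinear relation $$p(\eta y''-2\eta'y'+\eta''y)+\tfrac12 p'(\eta y'+\eta'y)+s(\eta y'-\eta'y)=0,$$ that is, $\eta\,(\hat T[y]-cy)$ equals the left-hand side for every rational function $y$. Equivalently, $\hat T=pD^2+\hat qD+\hat r$ with $$\hat q=\frac{p'}2+s-\frac{2p\eta'}{\eta},\qquad \hat r=\frac{p\eta''}{\eta}+\Big(\frac{p'}2-s\Big)\frac{\eta'}{\eta}+c .$$ -/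

import Mathlib

noncomputable section

open Polynomial

namespace ExcOp

/-- The inclusion of the polynomials `ℂ[z]` into the rational functions `ℂ(z)`. -/
abbrev ι : ℂ[X] →+* RatFunc ℂ := algebraMap ℂ[X] (RatFunc ℂ)

/-- Quotient rule applied to the reduced form of a rational function. -/
def derivFun (f : RatFunc ℂ) : RatFunc ℂ :=
  (ι (derivative f.num) * ι f.denom - ι f.num * ι (derivative f.denom)) / ι f.denom ^ 2

theorem ι_ne_zero {b : ℂ[X]} (hb : b ≠ 0) : ι b ≠ 0 :=
  RatFunc.algebraMap_ne_zero hb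

theorem derivFun_div (a b : ℂ[X]) (hb : b ≠ 0) :
    derivFun (ι a / ι b) = (ι (derivative a) * ι b - ι a * ι (derivative b)) / ι b ^ 2 := by
  set f : RatFunc ℂ := ι a / ι b with hf
  have hd : ι f.denom ≠ 0 := ι_ne_zero f.denom_ne_zero
  have hb' : ι b ≠ 0 := ι_ne_zero hb
  have h : f.num * b = a * f.denom := (RatFunc.num_mul_eq_mul_denom_iff hb).2 hf
  have h1 : ι f.num * ι b = ι a * ι f.denom := by rw [← map_mul, h, map_mul]
  have h2 : ι (derivative f.num) * ι b + ι f.num * ι (derivative b) =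
      ι (derivative a) * ι f.denom + ι a * ι (derivative f.denom) := by
    have := congrArg (fun x => ι (derivative x)) h
    simpa only [derivative_mul, map_add, map_mul] using this
  unfold derivFun
  rw [div_eq_div_iff (pow_ne_zero 2 hd) (pow_ne_zero 2 hb')]
  linear_combination (ι b * ι f.denom) * h2
    - (ι b * ι (derivative f.denom) + ι f.denom * ι (derivative b)) * h1

/-- The derivation `D = d/dz` of the field `ℂ(z)`. -/
def D : Derivation ℂ (RatFunc ℂ) (RatFunc ℂ) :=
  Derivation.mk'
    { toFun := derivFun
      map_add' := by
        intro f g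
        have hf := ι_ne_zero f.denom_ne_zero
        have hg := ι_ne_zero g.denom_ne_zero
        have e : f + g = ι (f.num * g.denom + f.denom * g.num) / ι (f.denom * g.denom) := by
          rw [map_add, map_mul, map_mul, map_mul, ← div_add_div _ _ hf hg,
            RatFunc.num_div_denom, RatFunc.num_div_denom]
        rw [e, derivFun_div _ _ (mul_ne_zero f.denom_ne_zero g.denom_ne_zero)]
        unfold derivFun
        simp only [derivative_mul, map_add, map_mul]
        field_simp
        ring
      map_smul' := by
        intro c f
        have hf := ι_ne_zero f.denom_ne_zero
        have e : c • f = ι (c • f.num) / ι f.denom := by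
          rw [Algebra.algebraMap_eq_smul_one, smul_assoc, ← Algebra.algebraMap_eq_smul_one,
            smul_div_assoc, RatFunc.num_div_denom]
        have hc : ∀ x : ℂ[X], ι (c • x) = c • ι x := by
          intro x
          rw [Algebra.algebraMap_eq_smul_one, smul_assoc, ← Algebra.algebraMap_eq_smul_one]
        rw [e, derivFun_div _ _ f.denom_ne_zero]
        unfold derivFun
        simp only [derivative_smul, hc, RingHom.id_apply, smul_mul_assoc, ← smul_sub,
          smul_div_assoc] }
    (by
      intro f g
      change derivFun (f * g) = f • derivFun g + g • derivFun f
      have hf := ι_ne_zero f.denom_ne_zero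
      have hg := ι_ne_zero g.denom_ne_zero
      have e : f * g = ι (f.num * g.num) / ι (f.denom * g.denom) := by
        rw [map_mul, map_mul, ← div_mul_div_comm, RatFunc.num_div_denom, RatFunc.num_div_denom]
      rw [e, derivFun_div _ _ (mul_ne_zero f.denom_ne_zero g.denom_ne_zero)]
      have ef : f = ι f.num / ι f.denom := (RatFunc.num_div_denom f).symm
      have eg : g = ι g.num / ι g.denom := (RatFunc.num_div_denom g).symm
      rw [smul_eq_mul, smul_eq_mul]
      have key : f * derivFun g + g * derivFun f =
          ι f.num / ι f.denom * derivFun g + ι g.num / ι g.denom * derivFun f := by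
        rw [← ef, ← eg]
      rw [key]
      unfold derivFun
      simp only [derivative_mul, map_add, map_mul]
      field_simp
      ring)

/-- On polynomials `D` is the usual derivative. -/
theorem D_ι (a : ℂ[X]) : D (ι a) = ι (derivative a) := by
  change derivFun (ι a) = _
  have h := derivFun_div a 1 one_ne_zero
  simpa using h

/-- A second order operator `p D² + q D + r` with rational coefficients, `p ≠ 0`. -/
structure RatDiffOp where
  p : RatFunc ℂ
  q : RatFunc ℂ
  r : RatFunc ℂ
  p_ne_zero : p ≠ 0

namespace RatDiffOp

/-- The action `y ↦ T[y] = p y'' + q y' + r y` on rational functions. -/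
def act (T : RatDiffOp) : RatFunc ℂ →ₗ[ℂ] RatFunc ℂ where
  toFun y := T.p * D (D y) + T.q * D y + T.r * y
  map_add' y z := by simp only [map_add]; ring
  map_smul' c y := by
    simp only [Derivation.map_smul, mul_smul_comm, smul_add, RingHom.id_apply]

/-- There is a polynomial of degree exactly `k` that is an eigenfunction of `T`. -/
def HasEigenpolynomial (T : RatDiffOp) (k : ℕ) : Prop :=
  ∃ y : ℂ[X], y ≠ 0 ∧ y.natDegree = k ∧ ∃ c : ℂ, T.act (ι y) = c • ι y

/-- `T` is exceptional: for some finite set `K` of exceptional degrees, `T` has an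
eigenpolynomial of degree `k` exactly when `k ∉ K`. The set `K` may be empty. -/
def IsExceptional (T : RatDiffOp) : Prop :=
  ∃ K : Finset ℕ, ∀ k : ℕ, k ∉ K ↔ T.HasEigenpolynomial k

/-- The polynomial subspace `V` is invariant under `T`: `T[y]` is a polynomial belonging to `V`
for each `y ∈ V`. -/
def IsInvariant (T : RatDiffOp) (V : Submodule ℂ ℂ[X]) : Prop :=
  ∀ y ∈ V, ∃ w ∈ V, T.act (ι y) = ι w

/-- The maximal invariant polynomial subspace of `T`. -/
def maxInvariant (T : RatDiffOp) : Submodule ℂ ℂ[X] :=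
  sSup {V | T.IsInvariant V}

/-- There is a largest invariant polynomial subspace, and it is `T.maxInvariant`. -/
theorem isGreatest_maxInvariant (T : RatDiffOp) :
    IsGreatest {V | T.IsInvariant V} T.maxInvariant := by
  refine ⟨?_, fun V hV => le_sSup hV⟩
  intro y hy
  change y ∈ sSup {V | T.IsInvariant V} at hy
  rw [sSup_eq_iSup'] at hy
  refine Submodule.iSup_induction _ (motive := fun y => ∃ w ∈ T.maxInvariant, T.act (ι y) = ι w)
    hy ?_ ?_ ?_
  · rintro ⟨V, hV⟩ x hx
    obtain ⟨w, hw, h⟩ := hV x hx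
    exact ⟨w, (le_sSup hV : V ≤ T.maxInvariant) hw, h⟩
  · exact ⟨0, zero_mem _, by simp⟩
  · rintro x y ⟨w, hw, h⟩ ⟨v, hv, h'⟩
    exact ⟨w + v, add_mem hw hv, by simp only [map_add, h, h']⟩

/-- The order sequence `I_ζ`: the orders of vanishing at `ζ` of the nonzero elements of the
maximal invariant polynomial subspace. -/
def orderSet (T : RatDiffOp) (ζ : ℂ) : Set ℕ :=
  {n | ∃ y ∈ T.maxInvariant, y ≠ 0 ∧ y.rootMultiplicity ζ = n}

/-- The gap cardinality `ν_ζ`, the number of elements of `ℕ \ I_ζ`. -/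
def gapCard (T : RatDiffOp) (ζ : ℂ) : ℕ := (T.orderSet ζ)ᶜ.ncard

/-- The finite set of poles of `T`: the points that are a pole of one of the coefficients
(`denom` is the denominator in lowest terms). -/
def poles (T : RatDiffOp) : Finset ℂ :=
  (T.p.denom * T.q.denom * T.r.denom).roots.toFinset

theorem mem_poles (T : RatDiffOp) (ζ : ℂ) :
    ζ ∈ T.poles ↔ T.p.denom.IsRoot ζ ∨ T.q.denom.IsRoot ζ ∨ T.r.denom.IsRoot ζ := by
  have hp := T.p.denom_ne_zero
  have hq := T.q.denom_ne_zero
  have hr := T.r.denom_ne_zero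
  simp [poles, hp, hq, hr, or_assoc]

/-- The polynomial `η(z) = ∏ (z - ζ)^{ν_ζ}`, the product being over the poles of `T`. -/
def eta (T : RatDiffOp) : ℂ[X] := ∏ ζ ∈ T.poles, (X - C ζ) ^ T.gapCard ζ

/-- `T'` is gauge-equivalent to `T`: `T' = σ T σ⁻¹` for a nonzero rational function `σ`. -/
def GaugeEquivalent (T' T : RatDiffOp) : Prop :=
  ∃ σ : RatFunc ℂ, σ ≠ 0 ∧ ∀ y : RatFunc ℂ, T'.act y = σ * T.act (σ⁻¹ * y)

/-- The operator `T - c` for a constant `c`. -/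
def subConst (T : RatDiffOp) (c : ℂ) : RatDiffOp where
  p := T.p
  q := T.q
  r := T.r - RatFunc.C c
  p_ne_zero := T.p_ne_zero

/-- `T` is a natural operator, with polynomial data `s` and `η`: `p` is a polynomial of degree at
most `2`, `s` has degree at most `1`, and `T[y]` multiplied by `η` is the bilinear expression
`p (η y'' - 2 η' y' + η'' y) + (1/2) p' (η y' + η' y) + s (η y' - η' y)`. -/
def IsNatural (T : RatDiffOp) (s η : ℂ[X]) : Prop :=
  (∃ p : ℂ[X], p.degree ≤ 2 ∧ T.p = ι p) ∧ s.degree ≤ 1 ∧ η ≠ 0 ∧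
    ∀ y : RatFunc ℂ, ι η * T.act y =
      T.p * (ι η * D (D y) - 2 * D (ι η) * D y + D (D (ι η)) * y)
        + 1 / 2 * D T.p * (ι η * D y + D (ι η) * y)
        + ι s * (ι η * D y - D (ι η) * y)

end RatDiffOp

end ExcOp

end

noncomputable section

open Polynomial

namespace ExcOp

/-! Everything is read off local expansions, and glued because a rational function without poles is
a polynomial. With x = z - ζ write T = x^(-μ)(P x²D² + Q x D + R), μ minimal. Then T lowers the
order at ζ of an element of the maximal invariant space U by exactly μ, unless that order is a root
of the indicial polynomial. Eigenpolynomials in almost all degrees make U of finite codimension, so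
almost all orders occur, and the least order in each class mod μ must be an indicial root. A nonzero
quadratic has at most two roots, so μ ≤ 2 (`LocalForm.le_two`).

At a pole with μ = 2 the roots are a and a + 2n + 1, of opposite parity, and fix the order set;
there are a + n gaps, and Vieta gives q the residue -2(a + n)p(ζ) (`LocalForm.exists_roots`). At a
pole with μ = 1, p vanishes and the orders are exactly those from one root on, by maximality of U
(`mem_orderSet_of_ge`). Hence p, and q + 2pη'/η - p'/2, are polynomials; comparing top coefficients
in the eigenvalue equations bounds their degrees (`IsExceptional.degLE`).

For the natural form, gauge so that the exponents at a pole with μ = 2 become N - n and N + n + 1.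
Their product must be N(N - 1) to match the double pole of pη''/η, which forces N = n(n+1)/2; poles
with μ = 1 are gauged away, with N = 0. The simple pole of r must also match. This is
`TwoRoots.ev_dl_R`: the orders a + 2i - 1 with i ≤ n are gaps, so certain second coefficients
vanish, and the resulting recursion has a solution only if its constant term is zero. What remains
of r is a polynomial bounded at infinity, the constant c (`IsNaturalOrder.exists_const`). -/

/-! ### Local rings of ℂ(z) and expansions in z - ζ. -/

/-- The local ring at `ζ`: the rational functions without a pole at `ζ`. -/
def localRing (ζ : ℂ) : Subalgebra ℂ (RatFunc ℂ) where
  carrier := {f | f.denom.eval ζ ≠ 0}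
  mul_mem' {f g} hf hg h := by
    have := Polynomial.eval_eq_zero_of_dvd_of_eval_eq_zero (RatFunc.denom_mul_dvd f g) h
    rw [eval_mul] at this
    exact (mul_ne_zero hf hg) this
  add_mem' {f g} hf hg h := by
    have := Polynomial.eval_eq_zero_of_dvd_of_eval_eq_zero (RatFunc.denom_add_dvd f g) h
    rw [eval_mul] at this
    exact (mul_ne_zero hf hg) this
  algebraMap_mem' c := by
    simp [RatFunc.algebraMap_eq_C]

variable {ζ : ℂ}

theorem mem_localRing {f : RatFunc ℂ} : f ∈ localRing ζ ↔ f.denom.eval ζ ≠ 0 := Iff.rfl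

/-- Evaluation at `ζ`. -/
def ev (ζ : ℂ) : localRing ζ →+* ℂ where
  toFun f := RatFunc.eval (RingHom.id ℂ) ζ f.1
  map_one' := by simp
  map_zero' := by simp
  map_add' f g := RatFunc.eval_add _ _ f.2 g.2
  map_mul' f g := RatFunc.eval_mul _ _ f.2 g.2

theorem ι_mem (ζ : ℂ) (a : ℂ[X]) : ι a ∈ localRing ζ := by
  simp [mem_localRing]

/-- A polynomial as an element of the local ring. -/
def loc (ζ : ℂ) : ℂ[X] →+* localRing ζ := ι.codRestrict (localRing ζ) (ι_mem ζ)

@[simp] theorem coe_loc (a : ℂ[X]) : (loc ζ a : RatFunc ℂ) = ι a := rfl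

@[simp] theorem ev_loc (a : ℂ[X]) : ev ζ (loc ζ a) = a.eval ζ := by
  change RatFunc.eval _ _ (ι a) = _
  simp [RatFunc.eval]

theorem inv_mem {f : localRing ζ} (hf : ev ζ f ≠ 0) : (f : RatFunc ℂ)⁻¹ ∈ localRing ζ := by
  have h0 : (f : RatFunc ℂ) ≠ 0 := by
    rintro h
    apply hf
    rw [show f = 0 from Subtype.ext h, map_zero]
  rw [mem_localRing]
  intro h
  have h1 := Polynomial.eval_eq_zero_of_dvd_of_eval_eq_zero (RatFunc.denom_inv_dvd h0) h
  apply hf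
  change RatFunc.eval _ _ _ = _
  rw [RatFunc.eval, ← Polynomial.eval, h1, zero_div]

theorem isUnit_of_ev_ne_zero {f : localRing ζ} (hf : ev ζ f ≠ 0) : IsUnit f := by
  refine IsUnit.of_mul_eq_one ⟨_, inv_mem hf⟩ (Subtype.ext ?_)
  have h0 : (f : RatFunc ℂ) ≠ 0 := by
    rintro h
    apply hf
    rw [show f = 0 from Subtype.ext h, map_zero]
  exact mul_inv_cancel₀ h0

theorem ev_ne_zero_of_isUnit {f : localRing ζ} (hf : IsUnit f) : ev ζ f ≠ 0 :=
  (hf.map (ev ζ)).ne_zero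

theorem coe_ne_zero {f : localRing ζ} (hf : ev ζ f ≠ 0) : (f : RatFunc ℂ) ≠ 0 := by
  rintro h
  apply hf
  rw [show f = 0 from Subtype.ext h, map_zero]

theorem D_eq (f : RatFunc ℂ) : D f =
    (ι (derivative f.num) * ι f.denom - ι f.num * ι (derivative f.denom)) / ι f.denom ^ 2 := rfl

theorem div_mem {a b : ℂ[X]} (hb : b.eval ζ ≠ 0) : ι a / ι b ∈ localRing ζ := by
  rw [div_eq_mul_inv]
  exact mul_mem (ι_mem ζ a) (inv_mem (f := loc ζ b) (by simpa using hb))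

theorem D_mem {f : RatFunc ℂ} (hf : f ∈ localRing ζ) : D f ∈ localRing ζ := by
  rw [D_eq, ← map_mul, ← map_mul, ← map_sub, ← map_pow]
  exact div_mem (by rw [eval_pow]; exact pow_ne_zero 2 hf)

/-- The derivation of the local ring. -/
def dl (ζ : ℂ) : Derivation ℂ (localRing ζ) (localRing ζ) :=
  Derivation.mk'
    { toFun f := ⟨D f.1, D_mem f.2⟩
      map_add' f g := Subtype.ext (by simp)
      map_smul' c f := Subtype.ext (by simp) }
    (fun f g => Subtype.ext (by simp))

@[simp] theorem coe_dl (f : localRing ζ) : ((dl ζ f : localRing ζ) : RatFunc ℂ) = D f := rfl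

@[simp] theorem dl_loc (a : ℂ[X]) : dl ζ (loc ζ a) = loc ζ (derivative a) :=
  Subtype.ext (D_ι a)

/-- The local parameter `z - ζ`. -/
def lp (ζ : ℂ) : localRing ζ := loc ζ (X - C ζ)

@[simp] theorem ev_lp : ev ζ (lp ζ) = 0 := by simp [lp]

@[simp] theorem dl_lp : dl ζ (lp ζ) = 1 := by simp [lp]

theorem coe_lp : (lp ζ : RatFunc ℂ) = ι (X - C ζ) := rfl

theorem lp_ne_zero : (lp ζ : RatFunc ℂ) ≠ 0 := ι_ne_zero (X_sub_C_ne_zero ζ)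

theorem D_lp : D (lp ζ : RatFunc ℂ) = 1 := by
  rw [← coe_dl, dl_lp]; rfl

theorem exists_eq_div (f : localRing ζ) : ∃ a b : ℂ[X], b.eval ζ ≠ 0 ∧ f * loc ζ b = loc ζ a := by
  refine ⟨f.1.num, f.1.denom, f.2, Subtype.ext ?_⟩
  exact ((div_eq_iff (ι_ne_zero f.1.denom_ne_zero)).1 (RatFunc.num_div_denom f.1)).symm

theorem exists_eq_lp_mul {f : localRing ζ} (hf : ev ζ f = 0) : ∃ g, f = lp ζ * g := by
  obtain ⟨a, b, hb, h⟩ := exists_eq_div f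
  have ha : a.eval ζ = 0 := by
    have := congrArg (ev ζ) h
    rw [map_mul, hf, zero_mul, ev_loc] at this
    exact this.symm
  obtain ⟨c, rfl⟩ := dvd_iff_isRoot.2 ha
  obtain ⟨u, hu⟩ := (isUnit_of_ev_ne_zero (f := loc ζ b) (by simpa using hb)).exists_right_inv
  refine ⟨loc ζ c * u, ?_⟩
  rw [map_mul] at h
  calc f = f * (loc ζ b * u) := by rw [hu, mul_one]
    _ = _ := by rw [← mul_assoc, h, lp]; ring

theorem exists_eq_lp_mul' {f : localRing ζ} (hf : ev ζ f = 0) :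
    ∃ g, f = lp ζ * g ∧ ev ζ g = ev ζ (dl ζ f) := by
  obtain ⟨g, rfl⟩ := exists_eq_lp_mul hf
  exact ⟨g, rfl, by simp⟩

theorem exists_zpow_mul {f : RatFunc ℂ} (hf : f ≠ 0) :
    ∃ (k : ℤ) (u : localRing ζ), ev ζ u ≠ 0 ∧ f = (lp ζ : RatFunc ℂ) ^ k * u := by
  have key : ∀ a : ℂ[X], a ≠ 0 → ∃ (k : ℕ) (u : localRing ζ), ev ζ u ≠ 0 ∧
      ι a = (lp ζ : RatFunc ℂ) ^ k * u := by
    intro a ha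
    obtain ⟨b, hb, h⟩ := exists_eq_pow_rootMultiplicity_mul_and_not_dvd a ha ζ
    refine ⟨a.rootMultiplicity ζ, loc ζ b, ?_, ?_⟩
    · rwa [ev_loc, Ne, ← IsRoot.def, ← dvd_iff_isRoot]
    · conv_lhs => rw [hb]
      simp [coe_lp]
  obtain ⟨k, u, hu, h⟩ := key f.num (RatFunc.num_ne_zero hf)
  obtain ⟨l, v, hv, h'⟩ := key f.denom f.denom_ne_zero
  obtain ⟨w, hw⟩ := (isUnit_of_ev_ne_zero hv).exists_right_inv
  refine ⟨k - l, u * w, ?_, ?_⟩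
  · rw [map_mul]
    refine mul_ne_zero hu (ev_ne_zero_of_isUnit (IsUnit.of_mul_eq_one v ?_))
    rw [mul_comm, hw]
  · have hw' : (v : RatFunc ℂ) * w = 1 := by exact_mod_cast congrArg Subtype.val hw
    have h1 := lp_ne_zero (ζ := ζ)
    have h2 := coe_ne_zero hv
    conv_lhs => rw [← RatFunc.num_div_denom f]
    change ι f.num / ι f.denom = _
    rw [h, h', zpow_sub₀ h1, zpow_natCast, zpow_natCast]
    push_cast
    rw [div_eq_iff (mul_ne_zero (pow_ne_zero _ h1) h2)]
    field_simp
    linear_combination (-(u : RatFunc ℂ)) * hw'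

theorem zpow_mul_mem {k : ℤ} (hk : 0 ≤ k) (u : localRing ζ) :
    (lp ζ : RatFunc ℂ) ^ k * u ∈ localRing ζ := by
  lift k to ℕ using hk
  rw [zpow_natCast]
  exact mul_mem (pow_mem (lp ζ).2 _) u.2

theorem zpow_nonneg_of_mem {k : ℤ} {u : localRing ζ} (hu : ev ζ u ≠ 0)
    (h : (lp ζ : RatFunc ℂ) ^ k * u ∈ localRing ζ) : 0 ≤ k := by
  by_contra hk
  obtain ⟨j, hj⟩ : ∃ j : ℕ, k = -(j + 1 : ℕ) := ⟨(-k - 1).toNat, by omega⟩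
  apply hu
  have h1 := lp_ne_zero (ζ := ζ)
  have : u = lp ζ ^ (j + 1) * ⟨_, h⟩ := by
    apply Subtype.ext
    push_cast
    rw [hj, zpow_neg, zpow_natCast]
    field_simp
  rw [this]
  simp

theorem zpow_unique {k l : ℤ} {u v : localRing ζ} (hu : ev ζ u ≠ 0) (hv : ev ζ v ≠ 0)
    (h : (lp ζ : RatFunc ℂ) ^ k * u = (lp ζ : RatFunc ℂ) ^ l * v) : k = l := by
  have h1 := lp_ne_zero (ζ := ζ)
  have e1 : (lp ζ : RatFunc ℂ) ^ (k - l) * u = v := by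
    rw [zpow_sub₀ h1, div_mul_eq_mul_div, h]
    field_simp
  have e2 : (lp ζ : RatFunc ℂ) ^ (l - k) * v = u := by
    rw [zpow_sub₀ h1, div_mul_eq_mul_div, ← h]
    field_simp
  have := zpow_nonneg_of_mem hu (e1 ▸ v.2)
  have := zpow_nonneg_of_mem hv (e2 ▸ u.2)
  omega

theorem rootMultiplicity_of_eq {y : ℂ[X]} {k : ℤ} {u : localRing ζ} (hu : ev ζ u ≠ 0)
    (h : ι y = (lp ζ : RatFunc ℂ) ^ k * u) : y ≠ 0 ∧ (y.rootMultiplicity ζ : ℤ) = k := by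
  have hy : y ≠ 0 := by
    rintro rfl
    rw [map_zero] at h
    exact mul_ne_zero (zpow_ne_zero _ lp_ne_zero) (coe_ne_zero hu) h.symm
  refine ⟨hy, ?_⟩
  obtain ⟨b, hb, hd⟩ := exists_eq_pow_rootMultiplicity_mul_and_not_dvd y hy ζ
  refine zpow_unique (u := loc ζ b) ?_ hu (Eq.trans ?_ h)
  · rwa [ev_loc, Ne, ← IsRoot.def, ← dvd_iff_isRoot]
  · conv_rhs => rw [hb]
    simp [coe_lp]

theorem exists_eq_pow_mul {y : ℂ[X]} (hy : y ≠ 0) (ζ : ℂ) : ∃ b : ℂ[X], b.eval ζ ≠ 0 ∧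
    y = (X - C ζ) ^ y.rootMultiplicity ζ * b := by
  obtain ⟨b, hb, hd⟩ := exists_eq_pow_rootMultiplicity_mul_and_not_dvd y hy ζ
  refine ⟨b, ?_, hb⟩
  rwa [Ne, ← IsRoot.def, ← dvd_iff_isRoot]

theorem dvd_of_mem {y : ℂ[X]} {k : ℕ} {u : localRing ζ}
    (h : ι y = (lp ζ : RatFunc ℂ) ^ (k : ℤ) * u) : (X - C ζ) ^ k ∣ y := by
  by_cases hy : y = 0
  · simp [hy]
  obtain ⟨b, hb, e⟩ := exists_eq_pow_mul hy ζ
  have : 0 ≤ (y.rootMultiplicity ζ : ℤ) - k := by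
    refine zpow_nonneg_of_mem (u := loc ζ b) (by simpa using hb) ?_
    have h1 := lp_ne_zero (ζ := ζ)
    convert u.2 using 1
    rw [zpow_sub₀ h1, div_mul_eq_mul_div, div_eq_iff (zpow_ne_zero _ h1), mul_comm (u : RatFunc ℂ),
      ← h]
    conv_rhs => rw [e]
    simp [coe_lp]
  exact (pow_dvd_pow _ (by omega)).trans (pow_rootMultiplicity_dvd y ζ)

/-- The passage from local to global: over ℂ a denominator without roots is constant. -/
theorem exists_polynomial {f : RatFunc ℂ} (h : ∀ ζ, f ∈ localRing ζ) : ∃ a : ℂ[X], f = ι a := by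
  have h0 : f.denom.natDegree = 0 := by
    by_contra hd
    obtain ⟨z, hz⟩ := Complex.exists_root (f := f.denom) (by
      rw [degree_eq_natDegree f.denom_ne_zero]
      exact_mod_cast Nat.pos_of_ne_zero hd)
    exact h z hz
  have h1 := (RatFunc.monic_denom f).natDegree_eq_zero.1 h0
  refine ⟨f.num, ?_⟩
  conv_lhs => rw [← RatFunc.num_div_denom f, h1]
  simp

/-- `θ_k u = k u + x u'`, so that `(x ^ k u)' = x ^ (k - 1) θ_k u`. -/
def theta (k : ℤ) (u : localRing ζ) : localRing ζ := (k : localRing ζ) * u + lp ζ * dl ζ u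

theorem D_zpow_mul (k : ℤ) (u : localRing ζ) :
    D ((lp ζ : RatFunc ℂ) ^ k * u) = (lp ζ : RatFunc ℂ) ^ (k - 1) * theta k u := by
  have h1 := lp_ne_zero (ζ := ζ)
  rw [Derivation.leibniz, Derivation.leibniz_zpow, D_lp, theta]
  push_cast
  simp only [smul_eq_mul, zsmul_eq_mul, coe_dl, zpow_sub_one₀ h1]
  field_simp
  ring

@[simp] theorem ev_theta (k : ℤ) (u : localRing ζ) : ev ζ (theta k u) = k * ev ζ u := by
  simp [theta]

@[simp] theorem ev_dl_theta (k : ℤ) (u : localRing ζ) :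
    ev ζ (dl ζ (theta k u)) = (k + 1) * ev ζ (dl ζ u) := by
  simp [theta]; ring

/-! ### Local form of an operator and its indicial polynomial. -/

namespace RatDiffOp

/-- At `ζ`, with `x = z - ζ`, `T = x ^ (-μ) (P x² D² + Q x D + R)` with `P, Q, R` regular. -/
structure LocalForm (T : RatDiffOp) (ζ : ℂ) (μ : ℕ) (P Q R : localRing ζ) : Prop where
  hp : T.p = (lp ζ : RatFunc ℂ) ^ (2 - μ : ℤ) * P
  hq : T.q = (lp ζ : RatFunc ℂ) ^ (1 - μ : ℤ) * Q
  hr : T.r = (lp ζ : RatFunc ℂ) ^ (-μ : ℤ) * R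

/-- `x ^ (μ - k) T[x ^ k u]` for `T` in local form. -/
def locAct (P Q R : localRing ζ) (k : ℤ) (u : localRing ζ) : localRing ζ :=
  P * theta (k - 1) (theta k u) + Q * theta k u + R * u

/-- The indicial polynomial `P(ζ) k (k - 1) + Q(ζ) k + R(ζ)`. -/
def indicial (P Q R : localRing ζ) (k : ℤ) : ℂ :=
  ev ζ P * (k * (k - 1)) + ev ζ Q * k + ev ζ R

@[simp] theorem ev_locAct (P Q R : localRing ζ) (k : ℤ) (u : localRing ζ) :
    ev ζ (locAct P Q R k u) = indicial P Q R k * ev ζ u := by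
  simp [locAct, indicial]; ring

/-- The coefficient after the leading one: the linear terms of `P`, `Q`, `R` act on the leading
coefficient of `u`, and the leading terms act on its linear coefficient, which sits at exponent `k +
1`. -/
theorem ev_dl_locAct (P Q R : localRing ζ) (k : ℤ) (u : localRing ζ) :
    ev ζ (dl ζ (locAct P Q R k u)) =
      indicial (dl ζ P) (dl ζ Q) (dl ζ R) k * ev ζ u + indicial P Q R (k + 1) * ev ζ (dl ζ u) := by
  simp [locAct, indicial]; ring

theorem act_apply (T : RatDiffOp) (y : RatFunc ℂ) :
    T.act y = T.p * D (D y) + T.q * D y + T.r * y := rfl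

theorem LocalForm.act_zpow_mul {T : RatDiffOp} {μ : ℕ} {P Q R : localRing ζ}
    (h : T.LocalForm ζ μ P Q R) (k : ℤ) (u : localRing ζ) :
    T.act ((lp ζ : RatFunc ℂ) ^ k * u) = (lp ζ : RatFunc ℂ) ^ (k - μ) * locAct P Q R k u := by
  have h1 := lp_ne_zero (ζ := ζ)
  rw [act_apply, D_zpow_mul, D_zpow_mul, h.hp, h.hq, h.hr, locAct]
  push_cast
  have e1 : (lp ζ : RatFunc ℂ) ^ (2 - μ : ℤ) * (lp ζ : RatFunc ℂ) ^ (k - 1 - 1) =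
    (lp ζ : RatFunc ℂ) ^ (k - μ) := by rw [← zpow_add₀ h1]; congr 1; ring
  have e2 : (lp ζ : RatFunc ℂ) ^ (1 - μ : ℤ) * (lp ζ : RatFunc ℂ) ^ (k - 1) =
    (lp ζ : RatFunc ℂ) ^ (k - μ) := by rw [← zpow_add₀ h1]; congr 1; ring
  have e3 : (lp ζ : RatFunc ℂ) ^ (-μ : ℤ) * (lp ζ : RatFunc ℂ) ^ k =
    (lp ζ : RatFunc ℂ) ^ (k - μ) := by rw [← zpow_add₀ h1]; congr 1; ring
  linear_combination (P * theta (k - 1) (theta k u) : RatFunc ℂ) * e1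
    + (Q * theta k u : RatFunc ℂ) * e2 + (R * u : RatFunc ℂ) * e3

theorem exists_pow_mul_mem (ζ : ℂ) (f : RatFunc ℂ) :
    ∃ N : ℕ, ∀ m : ℤ, N ≤ m → (lp ζ : RatFunc ℂ) ^ m * f ∈ localRing ζ := by
  by_cases hf : f = 0
  · exact ⟨0, fun m _ => by simp [hf]⟩
  obtain ⟨k, u, -, rfl⟩ := exists_zpow_mul (ζ := ζ) hf
  refine ⟨(-k).toNat, fun m hm => ?_⟩
  rw [← mul_assoc, ← zpow_add₀ lp_ne_zero]
  exact zpow_mul_mem (by omega) u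

theorem exists_localForm (T : RatDiffOp) (ζ : ℂ) : ∃ (μ : ℕ) (P Q R : localRing ζ),
    T.LocalForm ζ μ P Q R ∧ (μ = 0 ∨ ¬(ev ζ P = 0 ∧ ev ζ Q = 0 ∧ ev ζ R = 0)) := by
  classical
  have h1 := lp_ne_zero (ζ := ζ)
  have hex : ∃ (μ : ℕ) (P Q R : localRing ζ), T.LocalForm ζ μ P Q R := by
    obtain ⟨n₁, h₁⟩ := exists_pow_mul_mem ζ T.p
    obtain ⟨n₂, h₂⟩ := exists_pow_mul_mem ζ T.q
    obtain ⟨n₃, h₃⟩ := exists_pow_mul_mem ζ T.r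
    -- Some sufficiently large exponent works; the `+ 2` offsets the factor x² that accompanies D².
    refine ⟨n₁ + n₂ + n₃ + 2, ⟨_, h₁ (n₁ + n₂ + n₃) (by omega)⟩,
      ⟨_, h₂ (n₁ + n₂ + n₃ + 1) (by omega)⟩, ⟨_, h₃ (n₁ + n₂ + n₃ + 2) (by omega)⟩, ?_, ?_, ?_⟩ <;>
    · rw [← mul_assoc, ← zpow_add₀ h1]
      push_cast
      ring_nf
      simp
  obtain ⟨P, Q, R, h⟩ := Nat.find_spec hex
  refine ⟨Nat.find hex, P, Q, R, h, ?_⟩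
  by_contra! hc
  obtain ⟨h0, hP, hQ, hR⟩ := hc
  obtain ⟨m, hm⟩ := Nat.exists_eq_succ_of_ne_zero h0
  obtain ⟨P, rfl⟩ := exists_eq_lp_mul hP
  obtain ⟨Q, rfl⟩ := exists_eq_lp_mul hQ
  obtain ⟨R, rfl⟩ := exists_eq_lp_mul hR
  rw [hm] at h
  refine Nat.find_min hex (m := m) (by omega) ⟨P, Q, R, ?_, ?_, ?_⟩
  · rw [h.hp]
    push_cast
    rw [← mul_assoc, ← zpow_add_one₀ h1]; congr 2; ring
  · rw [h.hq]
    push_cast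
    rw [← mul_assoc, ← zpow_add_one₀ h1]; congr 2; ring
  · rw [h.hr]
    push_cast
    rw [← mul_assoc, ← zpow_add_one₀ h1]; congr 2; ring

theorem mem_of_notMem_poles {T : RatDiffOp} (h : ζ ∉ T.poles) :
    T.p ∈ localRing ζ ∧ T.q ∈ localRing ζ ∧ T.r ∈ localRing ζ := by
  rw [mem_poles] at h
  push Not at h
  exact h

theorem notMem_poles {T : RatDiffOp} (hp : T.p ∈ localRing ζ) (hq : T.q ∈ localRing ζ)
    (hr : T.r ∈ localRing ζ) : ζ ∉ T.poles := by
  rw [mem_poles]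
  push Not
  exact ⟨hp, hq, hr⟩

theorem LocalForm.notMem_poles {T : RatDiffOp} {P Q R : localRing ζ}
    (h : T.LocalForm ζ 0 P Q R) : ζ ∉ T.poles := by
  refine RatDiffOp.notMem_poles ?_ ?_ ?_
  · rw [h.hp]; exact zpow_mul_mem (by simp) _
  · rw [h.hq]; exact zpow_mul_mem (by simp) _
  · rw [h.hr]; exact zpow_mul_mem (by simp) _

theorem mem_orderSet_of_eq {T : RatDiffOp} {y : ℂ[X]} (hy : y ∈ T.maxInvariant) {k : ℤ}
    {u : localRing ζ} (hu : ev ζ u ≠ 0) (h : ι y = (lp ζ : RatFunc ℂ) ^ k * u) :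
    ∃ n ∈ T.orderSet ζ, (n : ℤ) = k := by
  obtain ⟨h0, h1⟩ := rootMultiplicity_of_eq hu h
  exact ⟨_, ⟨y, hy, h0, rfl⟩, h1⟩

theorem exists_of_mem_orderSet {T : RatDiffOp} {k : ℕ} (hk : k ∈ T.orderSet ζ) :
    ∃ y ∈ T.maxInvariant, ∃ u : localRing ζ, ev ζ u = 1 ∧ ι y = (lp ζ : RatFunc ℂ) ^ (k : ℤ) * u := by
  obtain ⟨y, hy, h0, rfl⟩ := hk
  obtain ⟨b, hb, e⟩ := exists_eq_pow_mul h0 ζ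
  refine ⟨(b.eval ζ)⁻¹ • y, Submodule.smul_mem _ _ hy, loc ζ (C (b.eval ζ)⁻¹ * b), ?_, ?_⟩
  · simp [hb]
  · conv_lhs => rw [e]
    rw [smul_eq_C_mul]
    rw [coe_loc, coe_lp, zpow_natCast, map_mul, map_mul, map_mul, map_pow]
    ring

theorem exists_act {T : RatDiffOp} {y : ℂ[X]} (hy : y ∈ T.maxInvariant) :
    ∃ w ∈ T.maxInvariant, T.act (ι y) = ι w :=
  T.isGreatest_maxInvariant.1 y hy

theorem le_maxInvariant {T : RatDiffOp} {V : Submodule ℂ ℂ[X]} (h : T.IsInvariant V) :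
    V ≤ T.maxInvariant :=
  T.isGreatest_maxInvariant.2 h

/-- Off the indicial roots the leading term survives, so applying `T` to an element of order `k`
gives an element of order exactly `k - μ`; in particular `μ ≤ k`. -/
theorem LocalForm.sub_mem_orderSet {T : RatDiffOp} {μ : ℕ} {P Q R : localRing ζ}
    (h : T.LocalForm ζ μ P Q R) {k : ℕ} (hk : k ∈ T.orderSet ζ) (hF : indicial P Q R k ≠ 0) :
    ∃ n ∈ T.orderSet ζ, n + μ = k := by
  obtain ⟨y, hy, u, hu, e⟩ := exists_of_mem_orderSet hk
  obtain ⟨w, hw, hT⟩ := exists_act hy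
  rw [e, h.act_zpow_mul] at hT
  obtain ⟨n, hn, h'⟩ := mem_orderSet_of_eq hw (by simpa [hu] using hF) hT.symm
  exact ⟨n, hn, by omega⟩

theorem ι_smul (c : ℂ) (y : ℂ[X]) : ι (c • y) = c • ι y := by
  rw [Algebra.algebraMap_eq_smul_one, smul_assoc, ← Algebra.algebraMap_eq_smul_one]

theorem mem_maxInvariant_of_eigen {T : RatDiffOp} {y : ℂ[X]} {c : ℂ}
    (h : T.act (ι y) = c • ι y) : y ∈ T.maxInvariant := by
  refine le_maxInvariant (V := Submodule.span ℂ {y}) ?_ (Submodule.mem_span_singleton_self y)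
  intro z hz
  obtain ⟨a, rfl⟩ := Submodule.mem_span_singleton.1 hz
  refine ⟨c • a • y, Submodule.smul_mem _ _ hz, ?_⟩
  rw [ι_smul, ι_smul, ι_smul, map_smul, h, smul_comm]

/-! ### Finite codimension of the invariant space and cofinite order sets. -/

theorem isExceptional_iff {T : RatDiffOp} :
    T.IsExceptional ↔ {k | ¬ T.HasEigenpolynomial k}.Finite := by
  constructor
  · rintro ⟨K, hK⟩
    refine K.finite_toSet.subset fun k hk => ?_
    by_contra h
    exact hk ((hK k).1 h)
  · intro h
    exact ⟨h.toFinset, fun k => by simp⟩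

theorem IsExceptional.exists_forall_ge {T : RatDiffOp} (hT : T.IsExceptional) :
    ∃ n, ∀ k, n ≤ k → T.HasEigenpolynomial k := by
  obtain ⟨n, hn⟩ := (isExceptional_iff.1 hT).bddAbove
  refine ⟨n + 1, fun k hk => ?_⟩
  by_contra h
  have : k ≤ n := hn h
  omega

/-- Eigenpolynomials span invariant lines, so they lie in the maximal space; cancelling leading
terms against them reduces every polynomial to degree below `n`. -/
theorem IsExceptional.finiteDimensional {T : RatDiffOp} (hT : T.IsExceptional) :
    FiniteDimensional ℂ (ℂ[X] ⧸ T.maxInvariant) := by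
  obtain ⟨n, hn⟩ := hT.exists_forall_ge
  have key : ∀ d, ∀ y : ℂ[X], y.natDegree < d → y ∈ T.maxInvariant ⊔ degreeLT ℂ n := by
    intro d
    induction d with
    | zero => intro y hy; omega
    | succ d ih =>
      intro y hy
      by_cases hd : d < n
      · refine Submodule.mem_sup_right (mem_degreeLT.2 ?_)
        by_cases h0 : y = 0
        · rw [h0, degree_zero]; exact WithBot.bot_lt_coe _
        · rw [degree_eq_natDegree h0]; exact_mod_cast (by omega)
      · obtain ⟨z, hz, hzd, c, hc⟩ := hn d (by omega)
        have hz' := Submodule.mem_sup_left (T := degreeLT ℂ n) (mem_maxInvariant_of_eigen hc)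
        -- Cancelling a constant does not lower `natDegree`, so degree zero is treated apart.
        by_cases hd0 : d = 0
        · subst hd0
          obtain ⟨b, rfl⟩ := natDegree_eq_zero.1 hzd
          obtain ⟨a, rfl⟩ := natDegree_eq_zero.1 (show y.natDegree = 0 by omega)
          have hb : b ≠ 0 := by rintro rfl; simp at hz
          have : C a = (a * b⁻¹) • C b := by
            rw [smul_C, smul_eq_mul, inv_mul_cancel_right₀ hb]
          rw [this]
          exact Submodule.smul_mem _ _ hz'
        · have e : y = (y - (y.coeff d / z.leadingCoeff) • z) + (y.coeff d / z.leadingCoeff) • z :=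
            (sub_add_cancel _ _).symm
          rw [e]
          refine add_mem (ih _ ?_) (Submodule.smul_mem _ _ hz')
          rw [Nat.lt_iff_le_pred (by omega), natDegree_le_iff_coeff_eq_zero]
          intro N hN
          rw [coeff_sub, coeff_smul, smul_eq_mul]
          rcases eq_or_lt_of_le (show d ≤ N by omega) with rfl | h
          · have := leadingCoeff_ne_zero.2 hz
            rw [leadingCoeff, hzd] at this ⊢
            field_simp
            ring
          · rw [coeff_eq_zero_of_natDegree_lt (p := y) (by omega),
              coeff_eq_zero_of_natDegree_lt (p := z) (by omega)]
            ring
  have hfin : FiniteDimensional ℂ (degreeLT ℂ n) := (degreeLTEquiv ℂ n).symm.finiteDimensional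
  refine Module.Finite.of_surjective (T.maxInvariant.mkQ.comp (degreeLT ℂ n).subtype) ?_
  intro q
  obtain ⟨y, rfl⟩ := Submodule.mkQ_surjective _ q
  obtain ⟨u, hu, v, hv, rfl⟩ := Submodule.mem_sup.1 (key (y.natDegree + 1) y (by omega))
  refine ⟨⟨v, hv⟩, ?_⟩
  simp only [LinearMap.comp_apply, Submodule.subtype_apply, map_add]
  rw [Submodule.mkQ_apply, Submodule.mkQ_apply, (Submodule.Quotient.mk_eq_zero _).2 hu, zero_add]

/-- Modulo a subspace of finite codimension, the powers of an ideal are eventually constant. -/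
theorem exists_forall_pow_mul (U : Submodule ℂ ℂ[X]) [FiniteDimensional ℂ (ℂ[X] ⧸ U)] (E : ℂ[X]) :
    ∃ n, ∀ (g : ℂ[X]) (M : ℕ), ∃ u ∈ U, ∃ h, E ^ n * g = u + E ^ M * h := by
  let L : ℕ → Submodule ℂ ℂ[X] := fun m => LinearMap.range (LinearMap.mulLeft ℂ (E ^ m))
  have hL : Antitone L := by
    rintro a b hab _ ⟨g, rfl⟩
    refine ⟨E ^ (b - a) * g, ?_⟩
    rw [LinearMap.mulLeft_apply, LinearMap.mulLeft_apply, ← mul_assoc, ← pow_add]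
    congr 2; omega
  obtain ⟨n, hn⟩ := IsArtinian.monotone_stabilizes (R := ℂ) (M := ℂ[X] ⧸ U)
    ⟨fun m => OrderDual.toDual ((L m).map U.mkQ), fun a b hab => Submodule.map_mono (hL hab)⟩
  refine ⟨n, fun g M => ?_⟩
  have hmem : U.mkQ (E ^ n * g) ∈ (L (n + M)).map U.mkQ := by
    have : (L n).map U.mkQ = (L (n + M)).map U.mkQ := hn (n + M) (by omega)
    rw [← this]
    exact Submodule.mem_map_of_mem ⟨g, rfl⟩
  obtain ⟨_, ⟨h, rfl⟩, e⟩ := hmem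
  refine ⟨E ^ n * g - E ^ (n + M) * h, ?_, E ^ n * h, ?_⟩
  · rw [← Submodule.Quotient.mk_eq_zero U, Submodule.Quotient.mk_sub, sub_eq_zero]
    exact e.symm
  · rw [pow_add]; ring

/-- For `k ≥ n` the power x^k agrees modulo x^(k+1) with an element of the invariant space, which
therefore has order `k`. -/
theorem IsExceptional.exists_forall_mem_orderSet {T : RatDiffOp} (hT : T.IsExceptional) (ζ : ℂ) :
    ∃ n, ∀ k, n ≤ k → k ∈ T.orderSet ζ := by
  have := hT.finiteDimensional
  obtain ⟨n, hn⟩ := exists_forall_pow_mul T.maxInvariant (X - C ζ)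
  refine ⟨n, fun k hk => ?_⟩
  obtain ⟨u, hu, h, e⟩ := hn ((X - C ζ) ^ (k - n)) (k + 1)
  rw [← pow_add, Nat.add_sub_cancel' hk] at e
  have e' : ι u = (lp ζ : RatFunc ℂ) ^ (k : ℤ) * (1 - lp ζ * loc ζ h : localRing ζ) := by
    rw [show u = (X - C ζ) ^ k - (X - C ζ) ^ (k + 1) * h by rw [e]; ring]
    rw [map_sub, map_mul, map_pow, map_pow, ← coe_lp, zpow_natCast]
    simp only [AddSubgroupClass.coe_sub, MulMemClass.coe_mul, OneMemClass.coe_one, coe_loc]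
    ring
  obtain ⟨m, hm, h'⟩ := mem_orderSet_of_eq hu (by simp) e'
  exact (show m = k by omega) ▸ hm

theorem IsExceptional.finite_compl_orderSet {T : RatDiffOp} (hT : T.IsExceptional) (ζ : ℂ) :
    (T.orderSet ζ)ᶜ.Finite := by
  obtain ⟨n, hn⟩ := hT.exists_forall_mem_orderSet ζ
  refine (Set.finite_Iio n).subset fun k hk => ?_
  by_contra h
  exact hk (hn k (by simpa using h))

end RatDiffOp

/-! ### Indicial roots and order sets at a pole. -/

namespace RatDiffOp

theorem quadratic_eq_zero {A B C : ℂ} {i j k : ℤ} (hij : i ≠ j) (hjk : j ≠ k) (hik : i ≠ k)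
    (hi : A * (i * (i - 1)) + B * i + C = 0) (hj : A * (j * (j - 1)) + B * j + C = 0)
    (hk : A * (k * (k - 1)) + B * k + C = 0) : A = 0 ∧ B = 0 ∧ C = 0 := by
  have h1 : (i - j : ℂ) ≠ 0 := sub_ne_zero.2 (by exact_mod_cast hij)
  have h2 : (j - k : ℂ) ≠ 0 := sub_ne_zero.2 (by exact_mod_cast hjk)
  have h3 : (i - k : ℂ) ≠ 0 := sub_ne_zero.2 (by exact_mod_cast hik)
  have e1 : A * (i + j - 1) + B = 0 := by
    apply mul_left_cancel₀ h1
    linear_combination hi - hj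
  have e2 : A * (j + k - 1) + B = 0 := by
    apply mul_left_cancel₀ h2
    linear_combination hj - hk
  have hA : A = 0 := by
    apply mul_left_cancel₀ h3
    linear_combination e1 - e2
  subst hA
  have hB : B = 0 := by simpa using e1
  subst hB
  exact ⟨rfl, rfl, by simpa using hi⟩

variable {T : RatDiffOp} {μ : ℕ} {P Q R : localRing ζ}

/-- If the least order in a residue class were not a root, `T` would produce a smaller one in the
same class. -/
theorem exists_root_mod (hT : T.IsExceptional) (h : T.LocalForm ζ μ P Q R) (hμ : 0 < μ) (r : ℕ) :
    ∃ k ∈ T.orderSet ζ, k % μ = r % μ ∧ indicial P Q R k = 0 ∧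
      ∀ j ∈ T.orderSet ζ, j % μ = r % μ → k ≤ j := by
  classical
  have hex : ∃ k, k ∈ T.orderSet ζ ∧ k % μ = r % μ := by
    obtain ⟨n, hn⟩ := hT.exists_forall_mem_orderSet ζ
    refine ⟨r + μ * n, hn _ ?_, by simp⟩
    nlinarith
  obtain ⟨h1, h2⟩ := Nat.find_spec hex
  refine ⟨Nat.find hex, h1, h2, ?_, fun j hj hj' => Nat.find_min' hex ⟨hj, hj'⟩⟩
  by_contra hF
  obtain ⟨n, hn, e⟩ := h.sub_mem_orderSet h1 hF
  refine Nat.find_min hex (m := n) (by omega) ⟨hn, ?_⟩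
  rw [← h2, ← e, Nat.add_mod_right]

theorem LocalForm.le_two (hT : T.IsExceptional) (h : T.LocalForm ζ μ P Q R)
    (h0 : ¬(ev ζ P = 0 ∧ ev ζ Q = 0 ∧ ev ζ R = 0)) : μ ≤ 2 := by
  by_contra hμ
  obtain ⟨i, -, hi, hi', -⟩ := exists_root_mod hT h (by omega) 0
  obtain ⟨j, -, hj, hj', -⟩ := exists_root_mod hT h (by omega) 1
  obtain ⟨k, -, hk, hk', -⟩ := exists_root_mod hT h (by omega) 2
  rw [Nat.zero_mod] at hi
  rw [Nat.mod_eq_of_lt (a := 1) (by omega)] at hj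
  rw [Nat.mod_eq_of_lt (a := 2) (by omega)] at hk
  refine h0 (quadratic_eq_zero (i := i) (j := j) (k := k) ?_ ?_ ?_ hi' hj' hk') <;>
  · intro e
    rw [Int.natCast_inj] at e
    subst e
    omega

/-- The least even and the least odd order are both roots, hence all the roots; `a` is the smaller.
Any large order descends in steps of two to the root of its parity without meeting another root. -/
theorem LocalForm.exists_roots (hT : T.IsExceptional) (h : T.LocalForm ζ 2 P Q R)
    (h0 : ¬(ev ζ P = 0 ∧ ev ζ Q = 0 ∧ ev ζ R = 0)) : ∃ a n : ℕ, ev ζ P ≠ 0 ∧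
      ev ζ Q = - ev ζ P * (2 * (a + n)) ∧ ev ζ R = ev ζ P * (a * (a + 2 * n + 1)) ∧
      ∀ k, k ∈ T.orderSet ζ ↔ a ≤ k ∧ k % 2 = a % 2 ∨ a + 2 * n + 1 ≤ k ∧ k % 2 ≠ a % 2 := by
  have key : ∃ a b : ℕ, a < b ∧ a % 2 ≠ b % 2 ∧ indicial P Q R a = 0 ∧ indicial P Q R b = 0 ∧
      (∀ j ∈ T.orderSet ζ, j % 2 = a % 2 → a ≤ j) ∧
      (∀ j ∈ T.orderSet ζ, j % 2 = b % 2 → b ≤ j) := by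
    obtain ⟨i, -, hi, hi', hi''⟩ := exists_root_mod hT h (by omega) 0
    obtain ⟨j, -, hj, hj', hj''⟩ := exists_root_mod hT h (by omega) 1
    rw [← hi] at hi''
    rw [← hj] at hj''
    rcases lt_or_ge i j with hij | hij
    · exact ⟨i, j, hij, by omega, hi', hj', hi'', hj''⟩
    · exact ⟨j, i, by omega, by omega, hj', hi', hj'', hi''⟩
  obtain ⟨a, b, hab, hpar, ha, hb, ha', hb'⟩ := key
  have hroots : ∀ k : ℕ, indicial P Q R k = 0 → k = a ∨ k = b := by
    intro k hk
    by_contra! hc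
    exact h0 (quadratic_eq_zero (i := a) (j := b) (k := k) (by omega) (by omega) (by omega) ha hb hk)
  have hmem : ∀ c : ℕ, (c = a ∨ c = b) → ∀ k, c ≤ k → k % 2 = c % 2 → k ∈ T.orderSet ζ := by
    intro c hc k hck hk
    obtain ⟨n, hn⟩ := hT.exists_forall_mem_orderSet ζ
    have hdesc : ∀ i, k + 2 * i ∈ T.orderSet ζ → k ∈ T.orderSet ζ := by
      intro i
      induction i with
      | zero => exact id
      | succ i ih =>
        intro hi
        obtain ⟨m, hm, e⟩ := h.sub_mem_orderSet hi (by
          intro h0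
          have := hroots _ h0
          omega)
        exact ih ((show m = k + 2 * i by omega) ▸ hm)
    exact hdesc n (hn _ (by omega))
  obtain ⟨n, rfl⟩ : ∃ n, b = a + 2 * n + 1 := ⟨(b - a) / 2, by omega⟩
  have hn : (2 * n + 1 : ℂ) ≠ 0 := by exact_mod_cast (2 * n).succ_ne_zero
  have hA : ev ζ Q = - ev ζ P * (2 * (a + n)) := by
    apply mul_left_cancel₀ hn
    simp only [indicial] at ha hb
    push_cast at ha hb
    linear_combination hb - ha
  have hC : ev ζ R = ev ζ P * (a * (a + 2 * n + 1)) := by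
    simp only [indicial] at ha
    push_cast at ha
    linear_combination ha - a * hA
  refine ⟨a, n, ?_, hA, hC, fun k => ⟨fun hk => ?_, ?_⟩⟩
  · intro hP
    rw [hP] at hA hC
    exact h0 ⟨hP, by simpa using hA, by simpa using hC⟩
  · by_cases hk2 : k % 2 = a % 2
    · exact Or.inl ⟨ha' k hk hk2, hk2⟩
    · exact Or.inr ⟨hb' k hk (by omega), hk2⟩
  · rintro (⟨h1, h2⟩ | ⟨h1, h2⟩)
    · exact hmem a (Or.inl rfl) k h1 h2
    · exact hmem _ (Or.inr rfl) k h1 (by omega)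

theorem gapCard_eq_add {a n : ℕ} (h : ∀ k, k ∈ T.orderSet ζ ↔
    a ≤ k ∧ k % 2 = a % 2 ∨ a + 2 * n + 1 ≤ k ∧ k % 2 ≠ a % 2) : T.gapCard ζ = a + n := by
  have hcompl : (T.orderSet ζ)ᶜ =
      ((Finset.range a ∪ (Finset.range n).image (fun i => a + 1 + 2 * i) : Finset ℕ) : Set ℕ) := by
    ext k
    rw [Set.mem_compl_iff, h]
    simp only [Finset.coe_union, Finset.coe_range, Finset.coe_image, Set.mem_union, Set.mem_Iio,
      Set.mem_image]
    constructor
    · intro hk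
      by_cases hka : k < a
      · exact Or.inl hka
      · exact Or.inr ⟨(k - a - 1) / 2, by omega, by omega⟩
    · rintro (hk | ⟨i, hi, rfl⟩) <;> omega
  rw [gapCard, hcompl, Set.ncard_coe_finset, Finset.card_union_of_disjoint, Finset.card_range,
    Finset.card_image_of_injective, Finset.card_range]
  · intro i j hij
    simp only at hij
    omega
  · rw [Finset.disjoint_left]
    intro k hk hk'
    simp only [Finset.mem_range, Finset.mem_image] at hk hk'
    obtain ⟨i, hi, rfl⟩ := hk'
    omega

theorem exists_pow_mul_eq (S : Finset ℂ) (f : RatFunc ℂ) (hf : ∀ ξ ∉ S, f ∈ localRing ξ) :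
    ∃ N, ∀ d, N ≤ d → ∃ a : ℂ[X], ι ((∏ ξ ∈ S, (X - C ξ)) ^ d) * f = ι a := by
  choose N hN using fun ξ => exists_pow_mul_mem ξ f
  refine ⟨∑ ξ ∈ S, N ξ, fun d hd => exists_polynomial fun ξ => ?_⟩
  by_cases hξ : ξ ∈ S
  · have h1 : N ξ ≤ d := (Finset.single_le_sum (fun _ _ => Nat.zero_le _) hξ).trans hd
    rw [← Finset.prod_erase_mul _ _ hξ, mul_pow, map_mul, mul_assoc]
    refine mul_mem (ι_mem _ _) ?_
    have := hN ξ d (by exact_mod_cast h1)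
    rwa [zpow_natCast, coe_lp, ← map_pow] at this
  · exact mul_mem (ι_mem _ _) (hf ξ hξ)

theorem exists_derivative_eq (E g : ℂ[X]) (m : ℕ) :
    ∃ h, derivative (E ^ (m + 1) * g) = E ^ m * h := by
  refine ⟨C (m + 1 : ℂ) * derivative E * g + E * derivative g, ?_⟩
  rw [derivative_mul, derivative_pow]
  push_cast
  simp only [map_add, map_natCast, map_one]
  ring

theorem exists_coeffs (T : RatDiffOp) : ∃ (d : ℕ) (A B G : ℂ[X]),
    (ι ((∏ ξ ∈ T.poles, (X - C ξ)) ^ d) * T.p = ι A) ∧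
    (ι ((∏ ξ ∈ T.poles, (X - C ξ)) ^ d) * T.q = ι B) ∧
    (ι ((∏ ξ ∈ T.poles, (X - C ξ)) ^ d) * T.r = ι G) := by
  obtain ⟨N₁, h₁⟩ := exists_pow_mul_eq T.poles T.p fun ξ hξ => (mem_of_notMem_poles hξ).1
  obtain ⟨N₂, h₂⟩ := exists_pow_mul_eq T.poles T.q fun ξ hξ => (mem_of_notMem_poles hξ).2.1
  obtain ⟨N₃, h₃⟩ := exists_pow_mul_eq T.poles T.r fun ξ hξ => (mem_of_notMem_poles hξ).2.2
  obtain ⟨A, hA⟩ := h₁ (N₁ + N₂ + N₃) (by omega)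
  obtain ⟨B, hB⟩ := h₂ (N₁ + N₂ + N₃) (by omega)
  obtain ⟨G, hG⟩ := h₃ (N₁ + N₂ + N₃) (by omega)
  exact ⟨_, A, B, G, hA, hB, hG⟩

theorem ι_mul_act {T : RatDiffOp} {V A B G : ℂ[X]} (hA : ι V * T.p = ι A) (hB : ι V * T.q = ι B)
    (hG : ι V * T.r = ι G) (y : ℂ[X]) : ι V * T.act (ι y) =
      ι (A * derivative (derivative y) + B * derivative y + G * y) := by
  rw [act_apply, D_ι, D_ι]
  simp only [map_add, map_mul, ← hA, ← hB, ← hG]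
  ring

/-- An indicial root `a` makes divisibility by x^a stable under `T` when `μ = 1`. Keeping the
conditions of the maximal space at the other poles and imposing only this one at `ζ` gives an
invariant space, hence contained in the maximal one, in which every order from `a` on occurs. -/
theorem mem_orderSet_of_ge (hT : T.IsExceptional) (h : T.LocalForm ζ 1 P Q R) (hζ : ζ ∈ T.poles)
    {a : ℕ} (ha : indicial P Q R a = 0) {k : ℕ} (hk : a ≤ k) : k ∈ T.orderSet ζ := by
  classical
  set E : ℂ[X] := ∏ ξ ∈ T.poles.erase ζ, (X - C ξ) with hE
  have hprod : ∏ ξ ∈ T.poles, (X - C ξ) = (X - C ζ) * E := (Finset.mul_prod_erase _ _ hζ).symm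
  have hEζ : E.eval ζ ≠ 0 := by
    rw [hE, eval_prod, Finset.prod_ne_zero_iff]
    intro ξ hξ
    simpa [sub_eq_zero] using (Finset.ne_of_mem_erase hξ).symm
  have hEne : E ≠ 0 := by rintro h0; simp [h0] at hEζ
  have hcop : IsCoprime (X - C ζ) E :=
    ((irreducible_X_sub_C ζ).coprime_iff_not_dvd).2 (by rwa [dvd_iff_isRoot])
  obtain ⟨d, A, B, G, hA, hB, hG⟩ := T.exists_coeffs
  rw [hprod] at hA hB hG
  -- Two derivatives and the denominator cost at most `d + 2` factors of `E`.
  have hact : ∀ (M : ℕ) (g : ℂ[X]), ∃ f : ℂ[X],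
      ι ((X - C ζ) ^ d) * T.act (ι (E ^ (M + d + 2) * g)) = ι (E ^ M * f) := by
    intro M g
    obtain ⟨g₁, h₁⟩ := exists_derivative_eq E g (M + d + 1)
    obtain ⟨g₂, h₂⟩ := exists_derivative_eq E g₁ (M + d)
    refine ⟨A * g₂ + B * (E * g₁) + G * (E ^ 2 * g), ?_⟩
    apply mul_left_cancel₀ (ι_ne_zero (pow_ne_zero d hEne))
    rw [← mul_assoc, ← map_mul, ← mul_pow, mul_comm E, ι_mul_act hA hB hG, h₁, h₂, ← map_mul]
    congr 1
    ring
  let V : Submodule ℂ ℂ[X] :=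
    -- The second condition says that `y` agrees with the maximal space to arbitrarily high order at
    -- all poles other than `ζ`.
    { carrier := {y | (X - C ζ) ^ a ∣ y ∧ ∀ M, ∃ u ∈ T.maxInvariant, ∃ g, y = u + E ^ M * g}
      zero_mem' := ⟨dvd_zero _, fun M => ⟨0, zero_mem _, 0, by simp⟩⟩
      add_mem' := by
        rintro y z ⟨hy, hy'⟩ ⟨hz, hz'⟩
        refine ⟨dvd_add hy hz, fun M => ?_⟩
        obtain ⟨u, hu, g, rfl⟩ := hy' M
        obtain ⟨v, hv, f, rfl⟩ := hz' M
        exact ⟨u + v, add_mem hu hv, g + f, by ring⟩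
      smul_mem' := by
        rintro c y ⟨hy, hy'⟩
        refine ⟨dvd_smul_of_dvd c hy, fun M => ?_⟩
        obtain ⟨u, hu, g, rfl⟩ := hy' M
        exact ⟨c • u, Submodule.smul_mem _ c hu, c • g, by rw [smul_add, mul_smul_comm]⟩ }
  have hV : T.IsInvariant V := by
    rintro y ⟨⟨y₀, hy₀⟩, hy⟩
    have hζ' : ∃ g : localRing ζ, T.act (ι y) = (lp ζ : RatFunc ℂ) ^ (a : ℤ) * g := by
      have e : ι y = (lp ζ : RatFunc ℂ) ^ (a : ℤ) * loc ζ y₀ := by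
        rw [hy₀, zpow_natCast, coe_lp, coe_loc, map_mul, map_pow]
      obtain ⟨g, hg⟩ := exists_eq_lp_mul (f := locAct P Q R a (loc ζ y₀)) (by
        rw [ev_locAct, ha, zero_mul])
      refine ⟨g, ?_⟩
      rw [e, h.act_zpow_mul, hg]
      push_cast
      rw [← mul_assoc, ← zpow_add_one₀ lp_ne_zero]
      congr 2
      ring
    have hsplit : ∀ M, ∃ u ∈ T.maxInvariant, ∃ f,
        ι ((X - C ζ) ^ d) * T.act (ι y) = ι ((X - C ζ) ^ d * u + E ^ M * f) := by
      intro M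
      obtain ⟨u, hu, g, e⟩ := hy (M + d + 2)
      obtain ⟨w, hw, hwu⟩ := exists_act hu
      obtain ⟨f, hf⟩ := hact M g
      refine ⟨w, hw, f, ?_⟩
      rw [e, map_add, map_add, mul_add, hf, hwu, map_add, map_mul _ _ w]
    obtain ⟨w, hw⟩ : ∃ w, T.act (ι y) = ι w := by
      refine exists_polynomial fun ξ => ?_
      by_cases hξ : ξ = ζ
      · subst hξ
        obtain ⟨g, hg⟩ := hζ'
        rw [hg]
        exact zpow_mul_mem (by simp) g
      · obtain ⟨u, hu, f, hf⟩ := hsplit 0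
        rw [mul_comm, ← eq_div_iff (ι_ne_zero (pow_ne_zero d (X_sub_C_ne_zero ζ)))] at hf
        rw [hf]
        exact div_mem (by simpa [sub_eq_zero] using fun h => absurd h hξ)
    refine ⟨w, ⟨?_, fun M => ?_⟩, hw⟩
    · obtain ⟨g, hg⟩ := hζ'
      exact dvd_of_mem (hw ▸ hg)
    · obtain ⟨u, hu, f, hf⟩ := hsplit M
      rw [hw, ← map_mul] at hf
      have hf' : (X - C ζ) ^ d * (w - u) = E ^ M * f := by
        have := RatFunc.algebraMap_injective ℂ hf
        linear_combination this
      -- The denominator at `ζ` is prime to `E`, so it can be cancelled from the congruence.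
      obtain ⟨g, hg⟩ := (hcop.pow (m := d) (n := M)).symm.dvd_of_dvd_mul_left ⟨f, hf'⟩
      exact ⟨u, hu, g, by linear_combination hg⟩
  have := hT.finiteDimensional
  obtain ⟨n, hn⟩ := exists_forall_pow_mul T.maxInvariant E
  have hmem : (X - C ζ) ^ k * E ^ n ∈ T.maxInvariant := by
    refine le_maxInvariant hV ⟨Dvd.dvd.mul_right (pow_dvd_pow _ hk) _, fun M => ?_⟩
    obtain ⟨u, hu, f, e⟩ := hn ((X - C ζ) ^ k) M
    exact ⟨u, hu, f, by rw [← e, mul_comm]⟩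
  obtain ⟨m, hm, e⟩ := mem_orderSet_of_eq (k := k) (u := loc ζ (E ^ n)) hmem
    (by rw [ev_loc, eval_pow]; exact pow_ne_zero n hEζ) (by
      rw [zpow_natCast, coe_lp, coe_loc, map_mul, map_pow])
  exact (show m = k by omega) ▸ hm

theorem LocalForm.exists_root (hT : T.IsExceptional) (h : T.LocalForm ζ 1 P Q R)
    (hζ : ζ ∈ T.poles) :
    indicial P Q R (T.gapCard ζ) = 0 ∧ ∀ k, k ∈ T.orderSet ζ ↔ T.gapCard ζ ≤ k := by
  obtain ⟨a, -, -, ha, hmin⟩ := exists_root_mod hT h one_pos 0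
  have hI : ∀ k, k ∈ T.orderSet ζ ↔ a ≤ k := fun k =>
    ⟨fun hk => hmin k hk (by simp [Nat.mod_one]), fun hk => mem_orderSet_of_ge hT h hζ ha hk⟩
  have : T.gapCard ζ = a := by
    have : (T.orderSet ζ)ᶜ = (Finset.range a : Set ℕ) := by
      ext k
      simp [hI]
    rw [gapCard, this, Set.ncard_coe_finset, Finset.card_range]
  rw [this]
  exact ⟨ha, hI⟩

end RatDiffOp

/-! ### Growth of the coefficients at infinity. -/

/-- The order of growth of `f` at infinity is at most `n`. -/
def DegLE (f : RatFunc ℂ) (n : ℤ) : Prop := f = 0 ∨ f.intDegree ≤ n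

namespace DegLE

variable {f g : RatFunc ℂ} {m n : ℤ}

theorem mono (hf : DegLE f m) (h : m ≤ n) : DegLE f n := hf.imp id fun h' => h'.trans h

theorem mul (hf : DegLE f m) (hg : DegLE g n) : DegLE (f * g) (m + n) := by
  by_cases hf0 : f = 0
  · exact Or.inl (by simp [hf0])
  by_cases hg0 : g = 0
  · exact Or.inl (by simp [hg0])
  refine Or.inr ?_
  rw [RatFunc.intDegree_mul hf0 hg0]
  exact add_le_add (hf.resolve_left hf0) (hg.resolve_left hg0)

theorem add (hf : DegLE f n) (hg : DegLE g n) : DegLE (f + g) n := by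
  by_cases hg0 : g = 0
  · simpa [hg0] using hf
  by_cases hf0 : f = 0
  · simpa [hf0] using hg
  by_cases hfg : f + g = 0
  · exact Or.inl hfg
  · exact Or.inr ((RatFunc.intDegree_add_le hg0 hfg).trans
      (max_le (hf.resolve_left hf0) (hg.resolve_left hg0)))

theorem neg (hf : DegLE f n) : DegLE (-f) n := by
  rcases hf with rfl | hf
  · exact Or.inl neg_zero
  · exact Or.inr (by rwa [RatFunc.intDegree_neg])

theorem sub (hf : DegLE f n) (hg : DegLE g n) : DegLE (f - g) n := by
  rw [sub_eq_add_neg]; exact hf.add hg.neg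

theorem of_natDegree_le {a : ℂ[X]} (h : (a.natDegree : ℤ) ≤ n) : DegLE (ι a) n :=
  Or.inr (by rwa [RatFunc.intDegree_polynomial])

theorem natDegree_le {a : ℂ[X]} {k : ℕ} (h : DegLE (ι a) k) : a.natDegree ≤ k := by
  rcases h with h | h
  · rw [(map_eq_zero_iff ι (RatFunc.algebraMap_injective ℂ)).1 h]; simp
  · rw [RatFunc.intDegree_polynomial] at h; exact_mod_cast h

theorem derivative (a : ℂ[X]) : DegLE (ι (derivative a)) (a.natDegree - 1) := by
  by_cases h : a.natDegree = 0
  · exact Or.inl (by rw [derivative_of_natDegree_zero h, map_zero])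
  · have := natDegree_derivative_lt h
    exact of_natDegree_le (by omega)

theorem inv (a : ℂ[X]) : DegLE (ι a)⁻¹ (-a.natDegree) :=
  Or.inr (by rw [RatFunc.intDegree_inv, RatFunc.intDegree_polynomial])

theorem D (hf : DegLE f n) : DegLE (D f) (n - 1) := by
  by_cases hf0 : f = 0
  · exact Or.inl (by simp [hf0])
  have h := hf.resolve_left hf0
  rw [RatFunc.intDegree] at h
  rw [D_eq, div_eq_mul_inv, ← map_pow]
  have h1 := ((derivative f.num).mul (of_natDegree_le (a := f.denom) le_rfl))
  have h2 := ((of_natDegree_le (a := f.num) le_rfl).mul (derivative f.denom))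
  refine ((h1.sub (h2.mono (by omega))).mul (inv _)).mono ?_
  rw [natDegree_pow]
  push_cast
  omega

theorem of_mul_eq {V a : ℂ[X]} (hV : V ≠ 0) (h : ι V * f = ι a)
    (hd : (a.natDegree : ℤ) ≤ V.natDegree + n) : DegLE f n := by
  have e : f = ι a * (ι V)⁻¹ := by
    rw [← h]
    have := ι_ne_zero hV
    field_simp
  rw [e]
  exact ((of_natDegree_le le_rfl).mul (inv V)).mono (by omega)

end DegLE

namespace RatDiffOp

variable {T : RatDiffOp}

/-- The coefficient of degree `M + 3 + j` is compared: it exceeds the degree of the right-hand side,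
and on the left only the top coefficients contribute. -/
theorem coeff_eq_zero_of_eigen {V A B G y : ℂ[X]} {c : ℂ} {M j : ℕ} (hM : V.natDegree ≤ M)
    (hA : A.natDegree ≤ M + 3) (hB : B.natDegree ≤ M + 2) (hG : G.natDegree ≤ M + 1)
    (hy : y ≠ 0) (hyj : y.natDegree = j + 2)
    (h : A * derivative (derivative y) + B * derivative y + G * y = V * (c • y)) :
    A.coeff (M + 3) * ((j + 2) * (j + 1)) + B.coeff (M + 2) * (j + 2) + G.coeff (M + 1) = 0 := by
  have d1 : (derivative y).natDegree ≤ j + 1 := (natDegree_derivative_le y).trans (by omega)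
  have d2 : (derivative (derivative y)).natDegree ≤ j :=
    (natDegree_derivative_le _).trans (by omega)
  have hc := congrArg (fun f => f.coeff (M + 3 + j)) h
  have e1 := coeff_mul_add_eq_of_natDegree_le hA d2
  have e2 := coeff_mul_add_eq_of_natDegree_le hB d1
  have e3 := coeff_mul_add_eq_of_natDegree_le hG hyj.le
  have e4 : (V * (c • y)).coeff (M + 3 + j) = 0 := by
    refine coeff_eq_zero_of_natDegree_lt (natDegree_mul_le.trans_lt ?_)
    have := natDegree_smul_le c y
    omega
  rw [show M + 2 + (j + 1) = M + 3 + j by ring, coeff_derivative] at e2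
  rw [show M + 1 + (j + 2) = M + 3 + j by ring] at e3
  rw [coeff_derivative, coeff_derivative] at e1
  simp only [coeff_add, e1, e2, e3, e4] at hc
  have hlc : y.coeff (j + 2) ≠ 0 := by
    rw [← hyj]; exact leadingCoeff_ne_zero.2 hy
  apply mul_right_cancel₀ hlc
  push_cast at hc
  linear_combination hc

/-- If the operator raised degrees, its top coefficients would form a quadratic in the degree of the
eigenpolynomial, vanishing at three consecutive degrees and so identically. The excess degree is
removed one unit at a time. -/
theorem IsExceptional.degLE (hT : T.IsExceptional) :
    DegLE T.p 2 ∧ DegLE T.q 1 ∧ DegLE T.r 0 := by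
  obtain ⟨d, A, B, G, hA, hB, hG⟩ := T.exists_coeffs
  set V := (∏ ξ ∈ T.poles, (X - C ξ)) ^ d with hV
  have hV0 : V ≠ 0 := pow_ne_zero _ (Finset.prod_ne_zero_iff.2 fun ξ _ => X_sub_C_ne_zero ξ)
  obtain ⟨n, hn⟩ := hT.exists_forall_ge
  have hcoeff : ∀ M : ℕ, V.natDegree ≤ M → A.natDegree ≤ M + 3 → B.natDegree ≤ M + 2 →
      G.natDegree ≤ M + 1 → A.coeff (M + 3) = 0 ∧ B.coeff (M + 2) = 0 ∧ G.coeff (M + 1) = 0 := by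
    intro M h0 h1 h2 h3
    have key : ∀ j : ℕ, n ≤ j → A.coeff (M + 3) * (((j + 2 : ℕ) : ℤ) * (((j + 2 : ℕ) : ℤ) - 1))
        + B.coeff (M + 2) * ((j + 2 : ℕ) : ℤ) + G.coeff (M + 1) = 0 := by
      intro j hj
      obtain ⟨y, hy, hyj, c, hc⟩ := hn (j + 2) (by omega)
      have := coeff_eq_zero_of_eigen h0 h1 h2 h3 hy hyj (c := c) (by
        apply RatFunc.algebraMap_injective ℂ
        rw [← ι_mul_act hA hB hG, hc, map_mul, ι_smul])
      push_cast
      linear_combination this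
    exact quadratic_eq_zero (by omega) (by omega) (by omega) (key n le_rfl) (key (n + 1) (by omega))
      (key (n + 2) (by omega))
  have hdesc : ∀ i, A.natDegree ≤ V.natDegree + i + 2 → B.natDegree ≤ V.natDegree + i + 1 →
      G.natDegree ≤ V.natDegree + i → A.natDegree ≤ V.natDegree + 2 ∧
        B.natDegree ≤ V.natDegree + 1 ∧ G.natDegree ≤ V.natDegree := by
    intro i
    induction i with
    | zero => exact fun h1 h2 h3 => ⟨h1, h2, h3⟩
    | succ i ih =>
      intro h1 h2 h3
      have hlt : ∀ (f : ℂ[X]) (m : ℕ), f.natDegree ≤ m + 1 → f.coeff (m + 1) = 0 →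
          f.natDegree ≤ m := by
        intro f m h h'
        by_contra hc
        have e : f.natDegree = m + 1 := by omega
        rw [← e, coeff_natDegree, leadingCoeff_eq_zero] at h'
        rw [h', natDegree_zero] at e
        omega
      obtain ⟨c1, c2, c3⟩ := hcoeff (V.natDegree + i) (by omega) (by omega) (by omega) (by omega)
      exact ih (hlt _ _ (by omega) c1) (hlt _ _ (by omega) c2) (hlt _ _ (by omega) c3)
  obtain ⟨h1, h2, h3⟩ := hdesc (A.natDegree + B.natDegree + G.natDegree) (by omega) (by omega)
    (by omega)
  exact ⟨.of_mul_eq hV0 hA (by omega), .of_mul_eq hV0 hB (by omega), .of_mul_eq hV0 hG (by omega)⟩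

end RatDiffOp

/-! ### Logarithmic derivatives and the formula for q. -/

@[simp, norm_cast] theorem coe_two : ((2 : localRing ζ) : RatFunc ℂ) = 2 := rfl

theorem D_div_self {k : ℤ} {h t : localRing ζ} (ht : h * t = 1) {f : RatFunc ℂ}
    (hf : f = (lp ζ : RatFunc ℂ) ^ k * h) :
    D f / f = (lp ζ : RatFunc ℂ) ^ (-1 : ℤ) * (theta k h * t : localRing ζ) := by
  have h1 := lp_ne_zero (ζ := ζ)
  have ht' : (h : RatFunc ℂ) * t = 1 := by exact_mod_cast congrArg Subtype.val ht
  have h0 : (h : RatFunc ℂ) ≠ 0 := left_ne_zero_of_mul_eq_one ht'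
  rw [hf, D_zpow_mul, div_eq_iff (mul_ne_zero (zpow_ne_zero _ h1) h0), zpow_sub_one₀ h1]
  push_cast
  rw [zpow_neg_one]
  linear_combination (-(lp ζ : RatFunc ℂ) ^ k * (lp ζ : RatFunc ℂ)⁻¹ * theta k h) * ht'

theorem D_D_div_self {k : ℤ} {h t : localRing ζ} (ht : h * t = 1) {f : RatFunc ℂ}
    (hf : f = (lp ζ : RatFunc ℂ) ^ k * h) :
    D (D f) / f =
      (lp ζ : RatFunc ℂ) ^ (-2 : ℤ) * (theta (k - 1) (theta k h) * t : localRing ζ) := by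
  have h1 := lp_ne_zero (ζ := ζ)
  have ht' : (h : RatFunc ℂ) * t = 1 := by exact_mod_cast congrArg Subtype.val ht
  have h0 : (h : RatFunc ℂ) ≠ 0 := left_ne_zero_of_mul_eq_one ht'
  rw [hf, D_zpow_mul, D_zpow_mul, div_eq_iff (mul_ne_zero (zpow_ne_zero _ h1) h0),
    zpow_sub_one₀ h1, zpow_sub_one₀ h1]
  push_cast
  rw [zpow_neg, zpow_ofNat]
  field_simp
  linear_combination (-(theta (k - 1) (theta k h) : RatFunc ℂ)) * ht'

theorem exists_prod_eq {S : Finset ℂ} (N : ℂ → ℕ) (hζ : ζ ∈ S) :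
    ∃ h t : localRing ζ, h * t = 1 ∧
      ι (∏ ξ ∈ S, (X - C ξ) ^ N ξ) = (lp ζ : RatFunc ℂ) ^ (N ζ : ℤ) * h := by
  classical
  have hE : (∏ ξ ∈ S.erase ζ, (X - C ξ) ^ N ξ).eval ζ ≠ 0 := by
    rw [eval_prod, Finset.prod_ne_zero_iff]
    intro ξ hξ
    rw [eval_pow]
    exact pow_ne_zero _ (by simpa [sub_eq_zero] using (Finset.ne_of_mem_erase hξ).symm)
  obtain ⟨t, ht⟩ := (isUnit_of_ev_ne_zero (f := loc ζ _) (by rwa [ev_loc])).exists_right_inv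
  refine ⟨_, t, ht, ?_⟩
  rw [← Finset.mul_prod_erase _ _ hζ, zpow_natCast, coe_lp, coe_loc, map_mul, map_pow]

theorem eval_prod_ne_zero {S : Finset ℂ} (N : ℂ → ℕ) (hζ : ζ ∉ S ∨ N ζ = 0) :
    (∏ ξ ∈ S, (X - C ξ) ^ N ξ).eval ζ ≠ 0 := by
  rw [eval_prod, Finset.prod_ne_zero_iff]
  intro ξ hξ
  rw [eval_pow]
  by_cases h : ζ = ξ
  · subst h
    rw [hζ.resolve_left (not_not.2 hξ), pow_zero]
    exact one_ne_zero
  · exact pow_ne_zero _ (by simpa [sub_eq_zero] using h)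

theorem prod_X_sub_C_ne_zero (S : Finset ℂ) (N : ℂ → ℕ) :
    ∏ ξ ∈ S, (X - C ξ) ^ N ξ ≠ (0 : ℂ[X]) :=
  Finset.prod_ne_zero_iff.2 fun ξ _ => pow_ne_zero _ (X_sub_C_ne_zero ξ)

namespace RatDiffOp

variable {T : RatDiffOp} {P Q R : localRing ζ}

theorem eta_ne_zero (T : RatDiffOp) : T.eta ≠ 0 := prod_X_sub_C_ne_zero _ _

/-- The structure of an exceptional operator at a pole where `p` vanishes: up to a power of
`z - ζ` it is regular. -/
structure OneRoot (T : RatDiffOp) (ζ : ℂ) (P Q R : localRing ζ) : Prop where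
  localForm : T.LocalForm ζ 1 P Q R
  root : indicial P Q R (T.gapCard ζ) = 0
  mem_iff : ∀ k, k ∈ T.orderSet ζ ↔ T.gapCard ζ ≤ k

/-- The structure of an exceptional operator at a pole where `p` does not vanish: the indicial
roots are `a` and `a + 2 n + 1`. -/
structure TwoRoots (T : RatDiffOp) (ζ : ℂ) (P Q R : localRing ζ) (a n : ℕ) : Prop where
  localForm : T.LocalForm ζ 2 P Q R
  ev_P : ev ζ P ≠ 0
  ev_Q : ev ζ Q = - ev ζ P * (2 * (a + n))
  ev_R : ev ζ R = ev ζ P * (a * (a + 2 * n + 1))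
  mem_iff : ∀ k, k ∈ T.orderSet ζ ↔
    a ≤ k ∧ k % 2 = a % 2 ∨ a + 2 * n + 1 ≤ k ∧ k % 2 ≠ a % 2

theorem TwoRoots.gapCard_eq {a n : ℕ} (h : T.TwoRoots ζ P Q R a n) : T.gapCard ζ = a + n :=
  gapCard_eq_add h.mem_iff

theorem LocalForm.exists_twoRoots (hT : T.IsExceptional) (h : T.LocalForm ζ 2 P Q R)
    (h0 : ¬(ev ζ P = 0 ∧ ev ζ Q = 0 ∧ ev ζ R = 0)) : ∃ a n, T.TwoRoots ζ P Q R a n := by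
  obtain ⟨a, n, h1, h2, h3, h4⟩ := h.exists_roots hT h0
  exact ⟨a, n, h, h1, h2, h3, h4⟩

theorem IsExceptional.oneRoot_or_twoRoots (hT : T.IsExceptional) (hζ : ζ ∈ T.poles) :
    ∃ P Q R : localRing ζ, T.OneRoot ζ P Q R ∨ ∃ a n, T.TwoRoots ζ P Q R a n := by
  obtain ⟨μ, P, Q, R, h, h0⟩ := T.exists_localForm ζ
  have hμ0 : μ ≠ 0 := by
    rintro rfl
    exact h.notMem_poles hζ
  replace h0 := h0.resolve_left hμ0
  have := h.le_two hT h0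
  obtain rfl | rfl : μ = 1 ∨ μ = 2 := by omega
  · obtain ⟨h1, h2⟩ := h.exists_root hT hζ
    exact ⟨P, Q, R, Or.inl ⟨h, h1, h2⟩⟩
  · exact ⟨P, Q, R, Or.inr (h.exists_twoRoots hT h0)⟩

theorem OneRoot.p_eq (h : T.OneRoot ζ P Q R) : T.p = (lp ζ * P : localRing ζ) := by
  rw [h.localForm.hp]
  norm_num

theorem TwoRoots.p_eq {a n : ℕ} (h : T.TwoRoots ζ P Q R a n) : T.p = P := by
  rw [h.localForm.hp]
  norm_num

theorem IsExceptional.exists_p (hT : T.IsExceptional) :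
    ∃ p : ℂ[X], p.degree ≤ 2 ∧ T.p = ι p := by
  obtain ⟨p, hp⟩ := exists_polynomial (f := T.p) fun ζ => by
    by_cases hζ : ζ ∈ T.poles
    · obtain ⟨P, Q, R, h | ⟨a, n, h⟩⟩ := hT.oneRoot_or_twoRoots hζ
      · rw [h.p_eq]; exact Subtype.prop _
      · rw [h.p_eq]; exact Subtype.prop _
    · exact (mem_of_notMem_poles hζ).1
  refine ⟨p, ?_, hp⟩
  have := hT.degLE.1
  rw [hp] at this
  exact natDegree_le_iff_degree_le.1 (DegLE.natDegree_le (k := 2) this)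

theorem DegLE_logDeriv (η : ℂ[X]) : DegLE (D (ι η) / ι η) (-1) := by
  rw [div_eq_mul_inv]
  exact ((DegLE.of_natDegree_le (a := η) le_rfl).D.mul (DegLE.inv η)).mono (by omega)

/-- With one root, `p` vanishes at `ζ` and cancels the simple pole of η'/η. With two, the residue of
`q` is -2p(ζ) times the gap cardinality and cancels the other term. -/
theorem IsExceptional.q_regular (hT : T.IsExceptional) (ζ : ℂ) :
    T.q + 2 * (T.p * (D (ι T.eta) / ι T.eta)) ∈ localRing ζ := by
  by_cases hζ : ζ ∈ T.poles
  · obtain ⟨h, t, ht, e⟩ := exists_prod_eq T.gapCard hζ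
    have e' := D_div_self ht e
    rw [eta, e']
    obtain ⟨P, Q, R, h' | ⟨a, n, h'⟩⟩ := hT.oneRoot_or_twoRoots hζ
    · rw [h'.p_eq, h'.localForm.hq]
      convert (Q + 2 * (P * (theta (T.gapCard ζ) h * t))).2 using 1
      push_cast
      have h1 := lp_ne_zero (ζ := ζ)
      norm_num
      field_simp
    · rw [h'.p_eq, h'.localForm.hq]
      have h0 : ev ζ (Q + 2 * (P * (theta (T.gapCard ζ) h * t))) = 0 := by
        have ht' := congrArg (ev ζ) ht
        rw [map_mul, map_one] at ht'
        simp only [map_add, map_mul, h'.ev_Q, ev_theta, map_ofNat, h'.gapCard_eq]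
        push_cast
        linear_combination (2 * ev ζ P * (a + n)) * ht'
      obtain ⟨g, hg⟩ := exists_eq_lp_mul h0
      convert g.2 using 1
      have hg' := congrArg Subtype.val hg
      push_cast at hg'
      have h1 := lp_ne_zero (ζ := ζ)
      apply mul_left_cancel₀ h1
      rw [← hg']
      push_cast
      norm_num
      field_simp
  · obtain ⟨hp, hq, -⟩ := mem_of_notMem_poles hζ
    refine add_mem hq (mul_mem (natCast_mem _ 2) (mul_mem hp ?_))
    rw [D_ι]
    exact div_mem (eval_prod_ne_zero _ (Or.inl hζ))

theorem IsExceptional.exists_s (hT : T.IsExceptional) : ∃ s : ℂ[X], s.degree ≤ 1 ∧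
    T.q = D T.p / 2 + ι s - 2 * T.p * D (ι T.eta) / ι T.eta := by
  obtain ⟨p, hp, hTp⟩ := hT.exists_p
  obtain ⟨s, hs⟩ := exists_polynomial
    (f := T.q + 2 * (T.p * (D (ι T.eta) / ι T.eta)) - ι (C (1 / 2)) * D T.p) fun ζ =>
      sub_mem (hT.q_regular ζ) (mul_mem (ι_mem _ _) (D_mem (hTp ▸ ι_mem ζ p)))
  have h2 : (2 : RatFunc ℂ) = ι (C 2) := by rw [map_ofNat C, map_ofNat]
  have hhalf : ι (C (1 / 2)) = (1 / 2 : RatFunc ℂ) := by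
    rw [eq_div_iff two_ne_zero, h2, ← map_mul, ← C_mul]
    norm_num
  refine ⟨s, ?_, ?_⟩
  · obtain ⟨h1, h2', -⟩ := hT.degLE
    refine natDegree_le_iff_degree_le.1 (DegLE.natDegree_le (k := 1) ?_)
    rw [← hs, h2]
    refine ((DegLE.add h2' ?_).sub ?_)
    · exact ((DegLE.of_natDegree_le (n := 0) (by simp)).mul
        (h1.mul (DegLE_logDeriv T.eta))).mono (by norm_num)
    · exact ((DegLE.of_natDegree_le (n := 0) (by simp)).mul h1.D).mono (by norm_num)
  · rw [← hs, hhalf]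
    ring

/-! ### Gauge transformations in local form. -/

/-- The gauge transform `τ⁻¹ T τ`. -/
def gauge (T : RatDiffOp) (τ : RatFunc ℂ) : RatDiffOp where
  p := T.p
  q := T.q + 2 * T.p * (D τ / τ)
  r := T.r + T.q * (D τ / τ) + T.p * (D (D τ) / τ)
  p_ne_zero := T.p_ne_zero

theorem gauge_act (T : RatDiffOp) {τ : RatFunc ℂ} (hτ : τ ≠ 0) (y : RatFunc ℂ) :
    (T.gauge τ).act y = τ⁻¹ * T.act (τ * y) := by
  rw [act_apply, act_apply]
  simp only [gauge, Derivation.leibniz, map_add, smul_eq_mul]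
  field_simp
  ring

theorem LocalForm.gauge {μ : ℕ} (h : T.LocalForm ζ μ P Q R) {k : ℤ} {u t : localRing ζ}
    (ht : u * t = 1) {τ : RatFunc ℂ} (hτ : τ = (lp ζ : RatFunc ℂ) ^ k * u) :
    (T.gauge τ).LocalForm ζ μ P (Q + 2 * P * (theta k u * t))
      (R + Q * (theta k u * t) + P * (theta (k - 1) (theta k u) * t)) := by
  have h1 := lp_ne_zero (ζ := ζ)
  have e1 : (lp ζ : RatFunc ℂ) ^ (2 - μ : ℤ) * (lp ζ : RatFunc ℂ) ^ (-1 : ℤ) =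
    (lp ζ : RatFunc ℂ) ^ (1 - μ : ℤ) := by rw [← zpow_add₀ h1]; congr 1; ring
  have e2 : (lp ζ : RatFunc ℂ) ^ (1 - μ : ℤ) * (lp ζ : RatFunc ℂ) ^ (-1 : ℤ) =
    (lp ζ : RatFunc ℂ) ^ (-μ : ℤ) := by rw [← zpow_add₀ h1]; congr 1; ring
  have e3 : (lp ζ : RatFunc ℂ) ^ (2 - μ : ℤ) * (lp ζ : RatFunc ℂ) ^ (-2 : ℤ) =
    (lp ζ : RatFunc ℂ) ^ (-μ : ℤ) := by rw [← zpow_add₀ h1]; congr 1; ring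
  refine ⟨h.hp, ?_, ?_⟩
  · simp only [RatDiffOp.gauge]
    rw [D_div_self ht hτ, h.hp, h.hq]
    push_cast
    linear_combination (2 * P * (theta k u * t) : RatFunc ℂ) * e1
  · simp only [RatDiffOp.gauge]
    rw [D_div_self ht hτ, D_D_div_self ht hτ, h.hp, h.hq, h.hr]
    push_cast
    linear_combination (Q * (theta k u * t) : RatFunc ℂ) * e2
      + (P * (theta (k - 1) (theta k u) * t) : RatFunc ℂ) * e3

theorem ev_gauge_Q {k : ℤ} {u t : localRing ζ} (ht : u * t = 1) :
    ev ζ (Q + 2 * P * (theta k u * t)) = ev ζ Q + 2 * ev ζ P * k := by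
  have ht' := congrArg (ev ζ) ht
  rw [map_mul, map_one] at ht'
  simp only [map_add, map_mul, ev_theta, map_ofNat]
  linear_combination (2 * ev ζ P * k) * ht'

theorem ev_gauge_R {k : ℤ} {u t : localRing ζ} (ht : u * t = 1) :
    ev ζ (R + Q * (theta k u * t) + P * (theta (k - 1) (theta k u) * t)) = indicial P Q R k := by
  have ht' := congrArg (ev ζ) ht
  rw [map_mul, map_one] at ht'
  simp only [map_add, map_mul, ev_theta, indicial]
  push_cast
  linear_combination (ev ζ Q * k + ev ζ P * (k * (k - 1))) * ht'

end RatDiffOp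

/-! ### The first order condition at a pole. -/

/-- A three term recursion without zeros of its coefficients inside the range of indices forces
its inhomogeneity to vanish. -/
theorem eq_zero_of_recursion {n : ℕ} {δ : ℂ} {e : ℕ → ℂ}
    (h : ∀ i ≤ n, δ + (2 * i + 1) * (2 * i - 2 * n) * e (i + 1) =
      2 * i * (2 * i - 2 * n - 1) * e i) : δ = 0 := by
  -- The signs of the coefficients keep every value a nonnegative real multiple of -δ.
  have key : ∀ i ≤ n, ∃ c : ℝ, 0 ≤ c ∧
      δ + (2 * i + 1) * (2 * i - 2 * n) * e (i + 1) = - (c * δ) := by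
    intro i
    induction i with
    | zero => exact fun h0 => ⟨0, le_rfl, by rw [h 0 h0]; simp⟩
    | succ i ih =>
      intro hi
      obtain ⟨c, hc, e'⟩ := ih (by omega)
      have hin : (i : ℝ) + 1 ≤ n := by exact_mod_cast hi
      have hpos : (0 : ℝ) < (2 * i + 1) * (2 * n - 2 * i) := by
        apply mul_pos <;> linarith [(Nat.cast_nonneg i : (0 : ℝ) ≤ i)]
      refine ⟨(1 + c) / ((2 * i + 1) * (2 * n - 2 * i)) *
        (2 * (i + 1) * (2 * n + 1 - 2 * (i + 1))), ?_, ?_⟩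
      · refine mul_nonneg (div_nonneg (by linarith) hpos.le) (mul_nonneg ?_ ?_) <;>
          linarith [(Nat.cast_nonneg i : (0 : ℝ) ≤ i)]
      · have hpos' : ((2 * i + 1) * (2 * n - 2 * i) : ℂ) ≠ 0 := by exact_mod_cast hpos.ne'
        have he : e (i + 1) = (1 + c) * δ / ((2 * i + 1) * (2 * n - 2 * i)) := by
          rw [eq_div_iff hpos']
          linear_combination -e'
        rw [h _ hi, he]
        push_cast
        field_simp
        ring
  -- At `i = n` the coefficient of `e (n + 1)` vanishes, leaving δ = -cδ with `c ≥ 0`.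
  obtain ⟨c, hc, e'⟩ := key n le_rfl
  have : ((1 + c : ℝ) : ℂ) * δ = 0 := by
    push_cast
    linear_combination e'
  exact (mul_eq_zero.1 this).resolve_left (by exact_mod_cast (by linarith : 1 + c ≠ 0))

namespace RatDiffOp

variable {T : RatDiffOp} {P Q R : localRing ζ}

theorem ev_dl_eq_zero {w : ℂ[X]} (hw : w ∈ T.maxInvariant) {k : ℤ} {v : localRing ζ}
    (hv : ev ζ v = 0) (e : ι w = (lp ζ : RatFunc ℂ) ^ (k - 2) * v)
    (hk : ∀ m ∈ T.orderSet ζ, (m : ℤ) ≠ k - 1) : ev ζ (dl ζ v) = 0 := by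
  by_contra hne
  obtain ⟨g, rfl, hg⟩ := exists_eq_lp_mul' hv
  rw [← hg] at hne
  obtain ⟨m, hm, h⟩ := mem_orderSet_of_eq (k := k - 1) hw hne (by
    rw [e]
    push_cast
    rw [← mul_assoc, ← zpow_add_one₀ lp_ne_zero]
    congr 2
    ring)
  exact hk m hm h

theorem ev_dl_C_mul (c : ℂ) (v : localRing ζ) :
    ev ζ (dl ζ (loc ζ (C c) * v)) = c * ev ζ (dl ζ v) := by
  simp

/-- Take `y i` of order `a + 2i` in the invariant space. Subtracting a multiple of `y (i - 1)` from
`T[y i]` kills the term of order `a + 2i - 2`, and the next order, `a + 2i - 1`, is a gap, so that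
coefficient vanishes too. -/
theorem TwoRoots.exists_recursion {a n : ℕ} (h : T.TwoRoots ζ P Q R a n) : ∃ e : ℕ → ℂ, ∀ i ≤ n,
    indicial (dl ζ P) (dl ζ Q) (dl ζ R) (a + 2 * i) +
      ev ζ P * ((2 * i + 1) * (2 * i - 2 * n)) * e (i + 1) =
      ev ζ P * (2 * i * (2 * i - 2 * n - 1)) * e i := by
  have hF : ∀ j : ℤ, indicial P Q R (a + j) = ev ζ P * (j * (j - 2 * n - 1)) := by
    intro j
    simp only [indicial, h.ev_Q, h.ev_R]
    push_cast
    ring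
  choose! y hy u hu e using fun i (_ : i ≤ n) => exists_of_mem_orderSet
    ((h.mem_iff (a + 2 * i)).2 (Or.inl ⟨by omega, by omega⟩))
  refine ⟨fun i => ev ζ (dl ζ (u (i - 1))), fun i hi => ?_⟩
  simp only [Nat.add_sub_cancel]
  obtain ⟨w, hw, hact⟩ := exists_act (hy i hi)
  rw [e i hi, h.localForm.act_zpow_mul] at hact
  push_cast at hact
  have hnot : ∀ m ∈ T.orderSet ζ, (m : ℤ) ≠ (a + 2 * i : ℤ) - 1 := by
    intro m hm hm'
    rcases (h.mem_iff m).1 hm with h1 | h1 <;> omega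
  have hF1 := hF (2 * i + 1)
  rw [← add_assoc] at hF1
  push_cast at hF1
  cases i with
  | zero =>
    have := ev_dl_eq_zero (k := a) hw (v := locAct P Q R a (u 0)) (by
      have := hF 0
      simp only [add_zero] at this
      rw [ev_locAct, this]; simp) (by rw [← hact]; simp) (by simpa using hnot)
    rw [ev_dl_locAct, hu 0 (by omega)] at this
    simp only [Nat.cast_zero, mul_zero, add_zero, zero_add] at hF1 ⊢
    rw [hF1] at this
    linear_combination this
  | succ i =>
    have hF2 := hF (2 * (i + 1 : ℕ))
    have := ev_dl_eq_zero (k := a + 2 * (i + 1 : ℕ))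
      (w := w - indicial P Q R (a + 2 * (i + 1 : ℕ)) • y i)
      (v := locAct P Q R (a + 2 * (i + 1 : ℕ)) (u (i + 1)) -
        loc ζ (C (indicial P Q R (a + 2 * (i + 1 : ℕ)))) * u i)
      (sub_mem hw (Submodule.smul_mem _ _ (hy i (by omega))))
      (by simp [hu (i + 1) hi, hu i (by omega)])
      (by
        rw [smul_eq_C_mul, map_sub, map_mul, ← hact, e i (by omega)]
        push_cast
        rw [show (a + 2 * (i + 1) - 2 : ℤ) = a + 2 * i by ring, coe_loc]
        ring)
      hnot
    rw [map_sub, map_sub, ev_dl_locAct, hu (i + 1) hi, ev_dl_C_mul, hF2] at this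
    push_cast at this hF1 ⊢
    rw [hF1] at this
    linear_combination this

/-- The first order condition at a pole, in the natural gauge. -/
theorem TwoRoots.ev_dl_R {a n : ℕ} (h : T.TwoRoots ζ P Q R a n) (han : 2 * (a + n) = n * (n + 1)) :
    ev ζ (dl ζ R) = - ev ζ (dl ζ P) * (a + n) ^ 2 - ev ζ (dl ζ Q) * (a + n) := by
  obtain ⟨e, he⟩ := h.exists_recursion
  have hA := h.ev_P
  -- α and β are chosen so that subtracting the affine function αk + β of the order `k` from the
  -- unknowns cancels the terms quadratic and linear in `i`. The constant left over is the δ below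
  -- exactly because of `han`.
  obtain ⟨α, hα⟩ : ∃ α, ev ζ (dl ζ P) = - (4 * ev ζ P * α) :=
    ⟨- ev ζ (dl ζ P) / (4 * ev ζ P), by field_simp⟩
  obtain ⟨β, hβ⟩ : ∃ β, ev ζ (dl ζ Q) = ev ζ P * (α * (6 * (a + n) - 2) - 2 * β) :=
    ⟨(α * (6 * (a + n) - 2) - ev ζ (dl ζ Q) / ev ζ P) / 2, by field_simp; ring⟩
  have han' : (a : ℂ) = n * (n + 1) / 2 - n := by
    have : (2 * (a + n) : ℂ) = n * (n + 1) := by exact_mod_cast han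
    linear_combination this / 2
  have key := eq_zero_of_recursion (n := n)
    (δ := (ev ζ (dl ζ R) - (- ev ζ (dl ζ P) * (a + n) ^ 2 - ev ζ (dl ζ Q) * (a + n))) / ev ζ P)
    (e := fun i => e i - (α * (a + 2 * i - 2) + β)) (by
      intro i hi
      apply mul_left_cancel₀ hA
      have := he i hi
      simp only [indicial] at this
      rw [mul_add, mul_div_cancel₀ _ hA]
      push_cast at this ⊢
      rw [hα, hβ] at this ⊢
      rw [han'] at this ⊢
      linear_combination this)
  rw [div_eq_zero_iff] at key
  exact sub_eq_zero.1 (key.resolve_right hA)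

end RatDiffOp

/-! ### The natural gauge. -/

namespace RatDiffOp

variable {T : RatDiffOp} {N : ℂ → ℕ}

/-- `N ζ` is the multiplicity at the pole `ζ` of the polynomial `η` in the natural gauge. -/
def IsNaturalOrder (T : RatDiffOp) (N : ℂ → ℕ) : Prop :=
  ∀ ζ ∈ T.poles, ∃ P Q R : localRing ζ, (T.OneRoot ζ P Q R ∧ N ζ = 0) ∨
    ∃ a n, T.TwoRoots ζ P Q R a n ∧ 2 * N ζ = n * (n + 1)

theorem IsExceptional.exists_isNaturalOrder (hT : T.IsExceptional) :
    ∃ N, T.IsNaturalOrder N := by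
  have : ∀ ζ : ℂ, ∃ m : ℕ, ζ ∈ T.poles → ∃ P Q R : localRing ζ, (T.OneRoot ζ P Q R ∧ m = 0) ∨
      ∃ a n, T.TwoRoots ζ P Q R a n ∧ 2 * m = n * (n + 1) := by
    intro ζ
    by_cases hζ : ζ ∈ T.poles
    · obtain ⟨P, Q, R, h | ⟨a, n, h⟩⟩ := hT.oneRoot_or_twoRoots hζ
      · exact ⟨0, fun _ => ⟨P, Q, R, Or.inl ⟨h, rfl⟩⟩⟩
      · refine ⟨n * (n + 1) / 2, fun _ => ⟨P, Q, R, Or.inr ⟨a, n, h, ?_⟩⟩⟩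
        exact Nat.mul_div_cancel' (Nat.even_mul_succ_self n).two_dvd
    · exact ⟨0, fun h => absurd h hζ⟩
  choose N hN using this
  exact ⟨N, hN⟩

/-- The polynomial `η` of the natural gauge. -/
def natEta (T : RatDiffOp) (N : ℂ → ℕ) : ℂ[X] := ∏ ξ ∈ T.poles, (X - C ξ) ^ N ξ

/-- The inverse of the gauge factor. -/
def natTau (T : RatDiffOp) (N : ℂ → ℕ) : RatFunc ℂ := ι T.eta / ι (T.natEta N)

theorem natEta_ne_zero : T.natEta N ≠ 0 := prod_X_sub_C_ne_zero _ _

theorem natTau_ne_zero : T.natTau N ≠ 0 :=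
  div_ne_zero (ι_ne_zero T.eta_ne_zero) (ι_ne_zero natEta_ne_zero)

theorem natTau_eq (hζ : ζ ∈ T.poles) : ∃ u t : localRing ζ, u * t = 1 ∧
    T.natTau N = (lp ζ : RatFunc ℂ) ^ (T.gapCard ζ - N ζ : ℤ) * u := by
  obtain ⟨h, t, ht, e⟩ := exists_prod_eq T.gapCard hζ
  obtain ⟨h', t', ht', e'⟩ := exists_prod_eq N hζ
  refine ⟨h * t', t * h', by linear_combination (h' * t') * ht + ht', ?_⟩
  have hc : (h' : RatFunc ℂ) * t' = 1 := by exact_mod_cast congrArg Subtype.val ht'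
  have h0 : (h' : RatFunc ℂ) ≠ 0 := left_ne_zero_of_mul_eq_one hc
  have h1 := lp_ne_zero (ζ := ζ)
  rw [natTau, natEta, eta, e, e', div_eq_iff (mul_ne_zero (zpow_ne_zero _ h1) h0), zpow_sub₀ h1]
  push_cast
  field_simp
  linear_combination (-(h : RatFunc ℂ)) * hc

theorem natTau_mem (hζ : ζ ∉ T.poles) :
    T.natTau N ∈ localRing ζ ∧ (T.natTau N)⁻¹ ∈ localRing ζ := by
  refine ⟨div_mem (eval_prod_ne_zero _ (Or.inl hζ)), ?_⟩
  rw [natTau, inv_div]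
  exact div_mem (eval_prod_ne_zero _ (Or.inl hζ))

theorem mul_mem_of_order {y : ℂ[X]} {k : ℤ} (u : localRing ζ)
    (h : y = 0 ∨ -k ≤ y.rootMultiplicity ζ) : (lp ζ : RatFunc ℂ) ^ k * u * ι y ∈ localRing ζ := by
  by_cases hy : y = 0
  · rw [hy, map_zero, mul_zero]; exact zero_mem _
  obtain ⟨b, -, e⟩ := exists_eq_pow_mul hy ζ
  have : (lp ζ : RatFunc ℂ) ^ k * u * ι y =
      (lp ζ : RatFunc ℂ) ^ (k + y.rootMultiplicity ζ) * (u * loc ζ b : localRing ζ) := by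
    conv_lhs => rw [e]
    rw [zpow_add₀ lp_ne_zero, zpow_natCast, map_mul, map_pow, ← coe_lp, MulMemClass.coe_mul,
      coe_loc]
    ring
  rw [this]
  exact zpow_mul_mem (by have := h.resolve_left hy; omega) _

theorem le_of_two_mul_eq {N n : ℕ} (h : 2 * N = n * (n + 1)) : n ≤ N := by
  rcases Nat.eq_zero_or_pos n with rfl | hn
  · omega
  · nlinarith

/-- The gauge factor maps the maximal invariant space to polynomials. -/
theorem IsNaturalOrder.exists_inv_mul (hN : T.IsNaturalOrder N) {y : ℂ[X]}
    (hy : y ∈ T.maxInvariant) : ∃ w : ℂ[X], (T.natTau N)⁻¹ * ι y = ι w := by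
  refine exists_polynomial fun ζ => ?_
  by_cases hζ : ζ ∈ T.poles
  · obtain ⟨u, t, ht, e⟩ := natTau_eq (N := N) hζ
    have hc : (u : RatFunc ℂ) * t = 1 := by exact_mod_cast congrArg Subtype.val ht
    have e' : (T.natTau N)⁻¹ = (lp ζ : RatFunc ℂ) ^ (N ζ - T.gapCard ζ : ℤ) * t := by
      rw [e, mul_inv, ← zpow_neg, neg_sub, inv_eq_of_mul_eq_one_right hc]
    rw [e']
    refine mul_mem_of_order t (or_iff_not_imp_left.2 fun hy0 => ?_)
    have hmem : y.rootMultiplicity ζ ∈ T.orderSet ζ := ⟨y, hy, hy0, rfl⟩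
    obtain ⟨P, Q, R, ⟨h, h0⟩ | ⟨a, n, h, hn⟩⟩ := hN ζ hζ
    · have := (h.mem_iff _).1 hmem
      omega
    · have h1 : a ≤ y.rootMultiplicity ζ := by
        rcases (h.mem_iff _).1 hmem with h' | h' <;> omega
      have h2 := h.gapCard_eq
      have h3 := le_of_two_mul_eq hn
      omega
  · exact mul_mem (natTau_mem hζ).2 (ι_mem ζ y)

theorem natDegree_of_natTau_mul {y w : ℂ[X]} (hy : y ≠ 0) (hw : w ≠ 0)
    (h : T.natTau N * ι w = ι y) :
    y.natDegree + (T.natEta N).natDegree = w.natDegree + T.eta.natDegree := by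
  have e : T.eta * w = y * T.natEta N := by
    apply RatFunc.algebraMap_injective ℂ
    have := ι_ne_zero (natEta_ne_zero (T := T) (N := N))
    change ι _ = ι _
    rw [map_mul, map_mul, ← h, natTau]
    field_simp
  rw [← natDegree_mul hy natEta_ne_zero, ← e, natDegree_mul T.eta_ne_zero hw, add_comm]

/-- The gauge carries eigenpolynomials to polynomial eigenfunctions and shifts all degrees by the
same amount, so only finitely many degrees can be missing. -/
theorem IsNaturalOrder.isExceptional_gauge (hN : T.IsNaturalOrder N) (hT : T.IsExceptional) :
    (T.gauge (T.natTau N)).IsExceptional := by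
  have hτ := natTau_ne_zero (T := T) (N := N)
  rw [isExceptional_iff]
  obtain ⟨n, hn⟩ := hT.exists_forall_ge
  refine (Set.finite_Iio (n + (T.natEta N).natDegree)).subset fun k hk => ?_
  by_contra hlt
  rw [Set.mem_Iio, not_lt] at hlt
  obtain ⟨y, hy, hyd, c, hc⟩ := hn (k + T.eta.natDegree - (T.natEta N).natDegree) (by omega)
  obtain ⟨w, hw⟩ := hN.exists_inv_mul (mem_maxInvariant_of_eigen hc)
  have hw' : T.natTau N * ι w = ι y := by rw [← hw, mul_inv_cancel_left₀ hτ]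
  have hw0 : w ≠ 0 := by
    rintro rfl
    rw [map_zero, mul_zero] at hw'
    exact ι_ne_zero hy hw'.symm
  refine hk ⟨w, hw0, ?_, c, ?_⟩
  · have := natDegree_of_natTau_mul hy hw0 hw'
    omega
  · rw [gauge_act _ hτ, hw', hc, mul_smul_comm, hw]

/-- The gauge moves the indicial root to 0, which removes the constant term of `R` and with it the
only pole left. -/
theorem IsNaturalOrder.notMem_poles_of_oneRoot {P Q R : localRing ζ} (h : T.OneRoot ζ P Q R)
    (h0 : N ζ = 0) (hζ : ζ ∈ T.poles) : ζ ∉ (T.gauge (T.natTau N)).poles := by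
  obtain ⟨u, t, ht, e⟩ := natTau_eq (N := N) hζ
  have hg := h.localForm.gauge ht e
  have hR := ev_gauge_R (P := P) (Q := Q) (R := R) (k := (T.gapCard ζ - N ζ : ℤ)) ht
  rw [h0] at hR hg
  rw [Nat.cast_zero, sub_zero, h.root] at hR
  rw [Nat.cast_zero, sub_zero] at hg
  obtain ⟨g, hg'⟩ := exists_eq_lp_mul hR
  refine RatDiffOp.notMem_poles ?_ ?_ ?_
  · rw [hg.hp]; exact zpow_mul_mem (by norm_num) _
  · rw [hg.hq]; exact zpow_mul_mem (by norm_num) _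
  · rw [hg.hr, hg']
    convert g.2 using 1
    push_cast
    rw [zpow_neg_one, inv_mul_cancel_left₀ lp_ne_zero]

/-- The values of `Q` and `R` at `ζ` give the sum and product of the new exponents, which are the
old ones shifted by `N ζ` minus the gap cardinality. -/
theorem TwoRoots.gauge_natTau {P Q R : localRing ζ} {a n : ℕ} (h : T.TwoRoots ζ P Q R a n)
    (hn : 2 * N ζ = n * (n + 1)) (hζ : ζ ∈ T.poles) (hT' : (T.gauge (T.natTau N)).IsExceptional) :
    ∃ (Q' R' : localRing ζ) (a' n' : ℕ), (T.gauge (T.natTau N)).TwoRoots ζ P Q' R' a' n' ∧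
      a' + n' = N ζ ∧ 2 * N ζ = n' * (n' + 1) := by
  obtain ⟨u, t, ht, e⟩ := natTau_eq (N := N) hζ
  have hg := h.localForm.gauge ht e
  obtain ⟨a', n', h'⟩ := hg.exists_twoRoots hT' fun hc => h.ev_P hc.1
  have hQ := h'.ev_Q
  have hR := h'.ev_R
  rw [ev_gauge_Q ht, h.ev_Q, h.gapCard_eq] at hQ
  rw [ev_gauge_R ht, indicial, h.ev_Q, h.ev_R, h.gapCard_eq] at hR
  push_cast at hQ hR
  have hA := h.ev_P
  have hn' : (2 * N ζ : ℂ) = n * (n + 1) := by exact_mod_cast hn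
  have hsum : (a' + n' : ℂ) = N ζ := by
    apply mul_left_cancel₀ hA
    linear_combination (1 / 2 : ℂ) * hQ
  have ha' : (a' : ℂ) = N ζ - n' := by linear_combination hsum
  refine ⟨_, _, a', n', h', by exact_mod_cast hsum, ?_⟩
  have : (2 * N ζ : ℂ) = n' * (n' + 1) := by
    apply mul_left_cancel₀ hA
    rw [ha'] at hR
    linear_combination ev ζ P * hn' - hR
  exact_mod_cast this

theorem notMem_poles_gauge (hζ : ζ ∉ T.poles) : ζ ∉ (T.gauge (T.natTau N)).poles := by
  obtain ⟨hp, hq, hr⟩ := mem_of_notMem_poles hζ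
  obtain ⟨h1, h2⟩ := natTau_mem (N := N) hζ
  refine notMem_poles hp (add_mem hq (mul_mem (mul_mem (natCast_mem _ 2) hp) ?_))
    (add_mem (add_mem hr (mul_mem hq ?_)) (mul_mem hp ?_)) <;> rw [div_eq_mul_inv]
  · exact mul_mem (D_mem h1) h2
  · exact mul_mem (D_mem h1) h2
  · exact mul_mem (D_mem (D_mem h1)) h2

/-- Poles may disappear under the gauge, but only where `N` is zero, so the product is unaffected.
-/
theorem IsNaturalOrder.eta_gauge (hN : T.IsNaturalOrder N) (hT : T.IsExceptional) :
    (T.gauge (T.natTau N)).eta = T.natEta N := by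
  have hT' := hN.isExceptional_gauge hT
  have hsub : (T.gauge (T.natTau N)).poles ⊆ T.poles := fun ζ hζ => by
    by_contra h
    exact notMem_poles_gauge h hζ
  have hstep : ∀ ζ ∈ T.poles, (ζ ∉ (T.gauge (T.natTau N)).poles → N ζ = 0) ∧
      (ζ ∈ (T.gauge (T.natTau N)).poles → (T.gauge (T.natTau N)).gapCard ζ = N ζ) := by
    intro ζ hζ
    obtain ⟨P, Q, R, ⟨h, h0⟩ | ⟨a, n, h, hn⟩⟩ := hN ζ hζ
    · exact ⟨fun _ => h0, fun h' => absurd h' (notMem_poles_of_oneRoot h h0 hζ)⟩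
    · obtain ⟨Q', R', a', n', h', hs, -⟩ := h.gauge_natTau hn hζ hT'
      refine ⟨fun hnot => ?_, fun _ => h'.gapCard_eq.trans hs⟩
      obtain ⟨-, hq, -⟩ := mem_of_notMem_poles hnot
      have hQ : Q' = lp ζ * ⟨_, hq⟩ := by
        apply Subtype.ext
        push_cast
        rw [h'.localForm.hq]
        have h1 := lp_ne_zero (ζ := ζ)
        norm_num
        field_simp
      have := h'.ev_Q
      rw [hQ, map_mul, ev_lp, zero_mul] at this
      have hz : (N ζ : ℂ) = 0 := by
        rw [← hs]
        push_cast
        apply mul_left_cancel₀ h.ev_P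
        linear_combination (1 / 2 : ℂ) * this
      exact_mod_cast hz
  rw [eta, natEta, ← Finset.prod_subset hsub fun ζ hζ hζ' => by
    rw [(hstep ζ hζ).1 hζ', pow_zero]]
  exact Finset.prod_congr rfl fun ζ hζ => by rw [(hstep ζ (hsub hζ)).2 hζ]

theorem half_eq : ι (C (1 / 2)) = (1 / 2 : RatFunc ℂ) := by
  rw [eq_div_iff two_ne_zero, show (2 : RatFunc ℂ) = ι (C 2) by rw [map_ofNat C, map_ofNat],
    ← map_mul, ← C_mul]
  norm_num

theorem gauge_q {s : ℂ[X]} (hs : T.q = D T.p / 2 + ι s - 2 * T.p * D (ι T.eta) / ι T.eta) :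
    (T.gauge (T.natTau N)).q = D T.p / 2 + ι s -
      2 * T.p * (D (ι (T.natEta N)) / ι (T.natEta N)) := by
  have h1 := ι_ne_zero T.eta_ne_zero
  have h2 := ι_ne_zero (natEta_ne_zero (T := T) (N := N))
  have hlog : D (T.natTau N) / T.natTau N =
      D (ι T.eta) / ι T.eta - D (ι (T.natEta N)) / ι (T.natEta N) := by
    rw [natTau, D_ι, D_ι]
    change derivFun _ / _ = _
    rw [derivFun_div _ _ natEta_ne_zero]
    field_simp
  rw [gauge, hlog, hs]
  ring

theorem ev_dl_mul (f g : localRing ζ) :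
    ev ζ (dl ζ (f * g)) = ev ζ f * ev ζ (dl ζ g) + ev ζ g * ev ζ (dl ζ f) := by
  simp

/-- Only poles with two roots and `N ζ ≠ 0` matter. There the double pole cancels by the choice of
`N`, and the simple pole by the first order condition. -/
theorem IsNaturalOrder.r_regular (hN : T.IsNaturalOrder N) (hT : T.IsExceptional) {p s : ℂ[X]}
    (hp : T.p = ι p) (hs : T.q = D T.p / 2 + ι s - 2 * T.p * D (ι T.eta) / ι T.eta) (ζ : ℂ) :
    (T.gauge (T.natTau N)).r - (T.p * (D (D (ι (T.natEta N))) / ι (T.natEta N)) +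
      (ι (C (1 / 2)) * D T.p - ι s) * (D (ι (T.natEta N)) / ι (T.natEta N))) ∈ localRing ζ := by
  have hreg : ζ ∉ (T.gauge (T.natTau N)).poles → (ζ ∉ T.poles ∨ N ζ = 0) →
      (T.gauge (T.natTau N)).r - (T.p * (D (D (ι (T.natEta N))) / ι (T.natEta N)) +
        (ι (C (1 / 2)) * D T.p - ι s) * (D (ι (T.natEta N)) / ι (T.natEta N))) ∈ localRing ζ := by
    intro h h'
    have h0 := eval_prod_ne_zero N h'
    refine sub_mem (mem_of_notMem_poles h).2.2 ?_
    rw [D_ι, D_ι, hp, D_ι, ← map_mul, ← map_sub]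
    exact add_mem (mul_mem (ι_mem _ _) (div_mem h0)) (mul_mem (ι_mem _ _) (div_mem h0))
  by_cases hζ : ζ ∈ T.poles
  swap
  · exact hreg (notMem_poles_gauge hζ) (Or.inl hζ)
  obtain ⟨P, Q, R, ⟨h, h0⟩ | ⟨a, n, h, hn⟩⟩ := hN ζ hζ
  · exact hreg (notMem_poles_of_oneRoot h h0 hζ) (Or.inr h0)
  obtain ⟨Q', R', a', n', h', hsum, hn'⟩ := h.gauge_natTau hn hζ (hN.isExceptional_gauge hT)
  obtain ⟨u, t, ht, e⟩ := exists_prod_eq N hζ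
  have h1 := lp_ne_zero (ζ := ζ)
  have hP : P = loc ζ p := Subtype.ext (by rw [← h.p_eq, hp, coe_loc])
  have hQ : Q' = lp ζ * (loc ζ (C (1 / 2)) * dl ζ P + loc ζ s) -
      2 * (P * (theta (N ζ) u * t)) := by
    apply Subtype.ext
    have := gauge_q (N := N) hs
    rw [h'.localForm.hq, natEta, D_div_self ht e, h.p_eq, div_eq_mul_one_div, ← half_eq] at this
    push_cast at this ⊢
    rw [coe_loc, coe_loc, coe_dl]
    norm_num only [zpow_neg_one] at this
    field_simp at this
    linear_combination this
  have e0 : ev ζ u * ev ζ t = 1 := by rw [← map_mul, ht, map_one]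
  have e1 : ev ζ (dl ζ u) * ev ζ t + ev ζ u * ev ζ (dl ζ t) = 0 := by
    have := congrArg (fun f => ev ζ (dl ζ f)) ht
    simp at this
    linear_combination this
  have hC := h'.ev_R
  have hC1 := h'.ev_dl_R (by rw [hsum, hn'])
  have hQ1 := congrArg (fun f => ev ζ (dl ζ f)) hQ
  have hsumC : (a' : ℂ) = N ζ - n' := by rw [← hsum]; push_cast; ring
  have hnC : (2 * N ζ : ℂ) = n' * (n' + 1) := by exact_mod_cast hn'
  rw [hsumC] at hC hC1
  -- `Z` is x² times the difference in question, so it must vanish to second order at `ζ`.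
  set Z := R' - (P * (theta (N ζ - 1) (theta (N ζ) u) * t) +
    lp ζ * ((loc ζ (C (1 / 2)) * dl ζ P - loc ζ s) * (theta (N ζ) u * t))) with hZ
  have hZ0 : ev ζ Z = 0 := by
    simp only [hZ, map_sub, map_add, map_mul, ev_theta, ev_lp, hC]
    push_cast
    linear_combination (- ev ζ P * (N ζ * (N ζ - 1))) * e0 + ev ζ P * hnC
  have hZ1 : ev ζ (dl ζ Z) = 0 := by
    have h2 : dl ζ 2 = 0 := (dl ζ).map_natCast 2
    simp only [map_sub, map_add, ev_dl_mul, ev_theta, ev_dl_theta, ev_lp, dl_lp, dl_loc, ev_loc,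
      h2, map_zero, map_one, map_mul, map_ofNat, eval_C] at hQ1
    simp only [hZ, hC1, hQ1, map_sub, map_add, ev_dl_mul, ev_theta, ev_dl_theta, ev_lp, dl_lp,
      ev_loc, map_one, map_mul, eval_C]
    push_cast
    linear_combination (-(ev ζ (dl ζ P) * (N ζ * (N ζ - 1))) + 2 * N ζ ^ 2 * ev ζ (dl ζ P) -
      (1 / 2 * ev ζ (dl ζ P) - s.eval ζ) * N ζ) * e0 + (N ζ + N ζ ^ 2) * ev ζ P * e1
  obtain ⟨g, hg, hg'⟩ := exists_eq_lp_mul' hZ0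
  rw [hZ1] at hg'
  obtain ⟨g, rfl⟩ := exists_eq_lp_mul hg'
  convert g.2 using 1
  rw [h'.localForm.hr, natEta, D_div_self ht e, D_D_div_self ht e, h.p_eq]
  have hg'' := congrArg Subtype.val hg
  rw [hZ] at hg''
  push_cast at hg'' ⊢
  rw [coe_loc, coe_loc, coe_dl] at hg''
  apply mul_left_cancel₀ (pow_ne_zero 2 h1)
  rw [zpow_neg, zpow_neg, zpow_ofNat, zpow_one]
  field_simp
  linear_combination hg''

end RatDiffOp

/-! ### The additive constant and the conclusion. -/

namespace RatDiffOp

variable {T : RatDiffOp} {N : ℂ → ℕ}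

/-- The difference is a polynomial by `r_regular` and is bounded at infinity by `degLE` for the
gauged operator, hence constant. -/
theorem IsNaturalOrder.exists_const (hN : T.IsNaturalOrder N) (hT : T.IsExceptional) {p s : ℂ[X]}
    (hp : T.p = ι p) (hs1 : s.degree ≤ 1)
    (hs : T.q = D T.p / 2 + ι s - 2 * T.p * D (ι T.eta) / ι T.eta) :
    ∃ c : ℂ, (T.gauge (T.natTau N)).r =
      T.p * (D (D (ι (T.natEta N))) / ι (T.natEta N)) +
        (1 / 2 * D T.p - ι s) * (D (ι (T.natEta N)) / ι (T.natEta N)) + RatFunc.C c := by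
  obtain ⟨f, hf⟩ := exists_polynomial (hN.r_regular hT hp hs)
  have hη : DegLE (ι (T.natEta N)) (T.natEta N).natDegree := .of_natDegree_le le_rfl
  have hdeg : DegLE (ι f) (0 : ℕ) := by
    obtain ⟨-, -, h3⟩ := (hN.isExceptional_gauge hT).degLE
    obtain ⟨h1, -, -⟩ := hT.degLE
    rw [← hf, div_eq_mul_inv (D (D _))]
    refine h3.sub (.add ((h1.mul (hη.D.D.mul (.inv _))).mono (by omega)) ?_)
    refine (DegLE.mul (m := 1) (.sub ?_ ?_) (DegLE_logDeriv (T.natEta N))).mono (by norm_num)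
    · exact ((DegLE.of_natDegree_le (n := 0) (by simp)).mul h1.D).mono (by norm_num)
    · exact .of_natDegree_le (by exact_mod_cast natDegree_le_iff_degree_le.2 hs1)
  obtain ⟨c, rfl⟩ := natDegree_eq_zero.1 (Nat.le_zero.1 hdeg.natDegree_le)
  refine ⟨c, ?_⟩
  rw [← RatFunc.algebraMap_C, ← hf, half_eq]
  ring

end RatDiffOp

open RatDiffOp in
theorem exists_natural_gauge (T : RatDiffOp) (hT : T.IsExceptional) :
    ∃ s : ℂ[X], s.degree ≤ 1 ∧ T.q = D T.p / 2 + ι s - 2 * T.p * D (ι T.eta) / ι T.eta ∧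
      ∃ (c : ℂ) (T' : RatDiffOp), T'.GaugeEquivalent T ∧ T'.IsExceptional ∧
        (T'.subConst c).IsNatural s T'.eta := by
  obtain ⟨p, hp, hTp⟩ := hT.exists_p
  obtain ⟨s, hs, hq⟩ := hT.exists_s
  obtain ⟨N, hN⟩ := hT.exists_isNaturalOrder
  obtain ⟨c, hc⟩ := hN.exists_const hT hTp hs hq
  refine ⟨s, hs, hq, c, T.gauge (T.natTau N), ⟨(T.natTau N)⁻¹, inv_ne_zero natTau_ne_zero,
    fun y => ?_⟩, hN.isExceptional_gauge hT, ⟨p, hp, hTp⟩, hs, eta_ne_zero _, fun y => ?_⟩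
  · rw [inv_inv, gauge_act _ natTau_ne_zero]
  · rw [act_apply, hN.eta_gauge hT]
    have h := ι_ne_zero (natEta_ne_zero (T := T) (N := N))
    simp only [subConst]
    rw [hc, gauge_q hq]
    change _ * (T.p * D (D y) + _ + _) = T.p * _ + 1 / 2 * D T.p * _ + _
    field_simp
    ring

end ExcOp

end

theorem mainTheorem3 (T : ExcOp.RatDiffOp) (hT : T.IsExceptional) :
    (∃ p : Polynomial ℂ, p.degree ≤ 2 ∧ T.p = ExcOp.ι p) ∧
    (∀ ζ : ℂ, (T.orderSet ζ)ᶜ.Finite) ∧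
    ∃ s : Polynomial ℂ, s.degree ≤ 1 ∧
      T.q = ExcOp.D T.p / 2 + ExcOp.ι s
        - 2 * T.p * ExcOp.D (ExcOp.ι T.eta) / ExcOp.ι T.eta ∧
      ∃ (c : ℂ) (T' : ExcOp.RatDiffOp),
        T'.GaugeEquivalent T ∧ T'.IsExceptional ∧ (T'.subConst c).IsNatural s T'.eta :=
  ⟨hT.exists_p, hT.finite_compl_orderSet, ExcOp.exists_natural_gauge T hT⟩
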